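/- There exist absolute constants $C_1,C_2>0$ with the following property. Let $n\ge 1$, $m>1$, $T>0$, let $\Omega\subset\mathbb R^n$ be a bounded domain, and put $\Omega_T=\Omega\times(0,T)$. Let $u$ be a weak supersolution of the porous medium equation $u_t-\Delta u^m=0$ in $\Omega_T$ with $u>0$ almost everywhere in $\Omega_T$; that is, $u\in L^2_{loc}(0,T;H^1_{loc}(\Omega))$, $u^m\in L^2_{loc}(0,T;H^1_{loc}(\Omega))$ and $$\iint_{\Omega_T}\big(-u\,\varphi_t+\nabla u^m\cdot\nabla\varphi\big)\,dx\,dt\ \ge\ 0\qquad\text{for all } \varphi\in C_0^\infty(\Omega_T)\text{ with }\varphi\ge 0,$$ where $\nabla$ denotes the (weak) gradient in $x$. Let $\zeta\in C_0^\infty(\Omega_T)$ satisfy $0\le\zeta\le 1$, and let $\varepsilon>0$, $\varepsilon\ne 1$. Then $$\int_0^T\!\!\int_\Omega m\,u^{m-\varepsilon-2}\zeta^2|\nabla u|^2\,dx\,dt+\frac{1}{\varepsilon|1-\varepsilon|}\operatorname*{ess\,sup}_{t\in(0,T)}\int_\Omega u^{1-\varepsilon}\zeta^2\,dx$$ $$\le\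 \frac{C_1 m}{\varepsilon^2}\int_0^T\!\!\int_\Omega u^{m-\varepsilon}|\nabla\zeta|^2\,dx\,dt+\frac{C_2}{\varepsilon|1-\varepsilon|}\int_0^T\!\!\int_\Omega u^{1-\varepsilon}\zeta|\zeta_t|\,dx\,dt,$$ where all integrals are of non-negative functions and take values in $[0,\infty]$. -/

import Mathlib

open MeasureTheory Set
open scoped ContDiff

namespace PME

/-- The space-time cylinder `Ω_T = Ω × (0,T)`. -/
def cylinder {n : ℕ} (Ω : Set (EuclideanSpace ℝ (Fin n))) (T : ℝ) :
    Set (EuclideanSpace ℝ (Fin n) × ℝ) :=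
  Ω ×ˢ Ioo 0 T

/-- Smooth real functions with compact support contained in the set `U`, i.e. `C_0^∞(U)`. -/
structure IsTestFunction {X : Type*} [NormedAddCommGroup X] [NormedSpace ℝ X]
    (U : Set X) (φ : X → ℝ) : Prop where
  contDiff : ContDiff ℝ ∞ φ
  hasCompactSupport : HasCompactSupport φ
  tsupport_subset : tsupport φ ⊆ U

/-- The spatial gradient `∇φ(x,t)` of a smooth function of `(x,t)`. -/
noncomputable def spaceGrad {n : ℕ} (φ : EuclideanSpace ℝ (Fin n) × ℝ → ℝ)
    (z : EuclideanSpace ℝ (Fin n) × ℝ) : EuclideanSpace ℝ (Fin n) :=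
  gradient (fun x => φ (x, z.2)) z.1

/-- The time derivative `φ_t(x,t)` of a smooth function of `(x,t)`. -/
noncomputable def timeDeriv {n : ℕ} (φ : EuclideanSpace ℝ (Fin n) × ℝ → ℝ)
    (z : EuclideanSpace ℝ (Fin n) × ℝ) : ℝ :=
  deriv (fun t => φ (z.1, t)) z.2

/-- `g` is the weak (distributional) gradient of `f` in `Ω`. -/
structure HasWeakGradient {n : ℕ} (Ω : Set (EuclideanSpace ℝ (Fin n)))
    (f : EuclideanSpace ℝ (Fin n) → ℝ)
    (g : EuclideanSpace ℝ (Fin n) → EuclideanSpace ℝ (Fin n)) : Prop where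
  locallyIntegrableOn : LocallyIntegrableOn f Ω
  locallyIntegrableOn_grad : LocallyIntegrableOn g Ω
  integral_eq : ∀ φ : EuclideanSpace ℝ (Fin n) → ℝ, IsTestFunction Ω φ →
    ∫ x in Ω, f x • gradient φ x = - ∫ x in Ω, φ x • g x

/-- `v ∈ L²_loc(0,T; H¹_loc(Ω))` with spatial weak gradient `Dv`: for almost every `t ∈ (0,T)`
the slice `Dv(·,t)` is the weak gradient of `v(·,t)` in `Ω`, and `v` and `Dv` are (measurable and)
square integrable on `K × [a,b]` for all compact `K ⊆ Ω` and `[a,b] ⊆ (0,T)`. -/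
structure MemL2LocH1Loc {n : ℕ} (Ω : Set (EuclideanSpace ℝ (Fin n))) (T : ℝ)
    (v : EuclideanSpace ℝ (Fin n) × ℝ → ℝ)
    (Dv : EuclideanSpace ℝ (Fin n) × ℝ → EuclideanSpace ℝ (Fin n)) : Prop where
  hasWeakGradient : ∀ᵐ t ∂(volume.restrict (Ioo 0 T)),
    HasWeakGradient Ω (fun x => v (x, t)) (fun x => Dv (x, t))
  memLp : ∀ K : Set (EuclideanSpace ℝ (Fin n)), IsCompact K → K ⊆ Ω →
    ∀ a b : ℝ, 0 < a → b < T → MemLp v 2 (volume.restrict (K ×ˢ Icc a b))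
  memLp_grad : ∀ K : Set (EuclideanSpace ℝ (Fin n)), IsCompact K → K ⊆ Ω →
    ∀ a b : ℝ, 0 < a → b < T → MemLp Dv 2 (volume.restrict (K ×ˢ Icc a b))

/-- Non-negative weak supersolutions of the porous medium equation `u_t - Δ(u^m) = 0`
in `Ω × (0,T)`. Weak gradients are unique almost everywhere, so that it does not matter which
representative `Dum` of `∇(u^m)` is used. -/
structure IsWeakSupersolution {n : ℕ} (m : ℝ) (Ω : Set (EuclideanSpace ℝ (Fin n))) (T : ℝ)
    (u : EuclideanSpace ℝ (Fin n) × ℝ → ℝ) : Prop where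
  nonneg : ∀ᵐ z ∂(volume.restrict (cylinder Ω T)), 0 ≤ u z
  mem : ∃ Du, MemL2LocH1Loc Ω T u Du
  supersolution : ∃ Dum, MemL2LocH1Loc Ω T (fun z => u z ^ m) Dum ∧
    ∀ φ : EuclideanSpace ℝ (Fin n) × ℝ → ℝ, IsTestFunction (cylinder Ω T) φ → (∀ z, 0 ≤ φ z) →
      0 ≤ ∫ z in cylinder Ω T, (-(u z * timeDeriv φ z) + inner ℝ (Dum z) (spaceGrad φ z))

end PME

open Filter Topology Convolution

namespace PME

/-! Formally, one tests the inequality with $u^{-\varepsilon}\zeta^2\chi(t)$. As $\nabla u^m=m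
u^{m-1}\nabla u$, the diffusion term gives $-\varepsilon\iint m u^{m-\varepsilon-2}|\nabla
u|^2\zeta^2\chi$ and a cross term with $\nabla\zeta$; Young's inequality absorbs the latter into
half of the former (`energy_integrand_le`). The time term is the derivative of
$u^{1-\varepsilon}/(1-\varepsilon)$ and moves onto $\zeta^2\chi$. With $\chi\equiv1$ this bounds the
gradient integral. With $\chi$ monotone in the direction given by the sign of $1-\varepsilon$, and
$|\chi'|$ concentrating at a time $\tau$, it bounds the slice integral at $\tau$. Both bounds have
the same right-hand side.

Two points need care. First, $u^{-\varepsilon}$ may be unbounded, so $(u+\delta)^{-\varepsilon}$ is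
used (`LocalSupersolution.energy_estimate`), and $\delta\to0$ only at the end, by Fatou's lemma
(`LocalSupersolution.caccioppoli`). Secondly, $u$ has no time derivative. Mollification in
space-time turns the weak inequality into a pointwise one for smooth functions, where multiplication
by $f(u_k)\eta$ and integration by parts are classical; `supersolution_test_comp` passes to the
limit. There the products of mollified gradients are dominated by mollifications of squares, which
converge almost everywhere and have constant integral, so Pratt's theorem applies.

The chain rule for $u^m$ is not assumed: it is proved in `IsWeakLineDeriv.rpow_ae_eq` from the
existence of both weak gradients. -/

/-! ### Convergence of integrals under varying dominating functions -/

/-- Generalised dominated convergence (Pratt): the dominating functions may vary, provided that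
they converge almost everywhere and so do their integrals. -/
theorem tendsto_integral_of_pratt {α : Type*} [MeasurableSpace α] {μ : Measure α}
    {f D : ℕ → α → ℝ} {g E : α → ℝ}
    (hf : ∀ k, AEStronglyMeasurable (f k) μ) (hD : ∀ k, Integrable (D k) μ) (hE : Integrable E μ)
    (hbound : ∀ k, ∀ᵐ x ∂μ, |f k x| ≤ D k x)
    (hfg : ∀ᵐ x ∂μ, Tendsto (fun k => f k x) atTop (𝓝 (g x)))
    (hDE : ∀ᵐ x ∂μ, Tendsto (fun k => D k x) atTop (𝓝 (E x)))
    (hint : Tendsto (fun k => ∫ x, D k x ∂μ) atTop (𝓝 (∫ x, E x ∂μ))) :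
    Integrable g μ ∧ Tendsto (fun k => ∫ x, f k x ∂μ) atTop (𝓝 (∫ x, g x ∂μ)) := by
  have hgm : AEStronglyMeasurable g μ := aestronglyMeasurable_of_tendsto_ae atTop hf hfg
  have hgE : ∀ᵐ x ∂μ, |g x| ≤ E x := by
    filter_upwards [hfg, hDE, ae_all_iff.2 hbound] with x h1 h2 h3
    exact le_of_tendsto_of_tendsto' h1.abs h2 h3
  have hg : Integrable g μ := hE.mono' hgm hgE
  have hfi : ∀ k, Integrable (f k) μ := fun k => (hD k).mono' (hf k) (hbound k)
  refine ⟨hg, ?_⟩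
  apply tendsto_integral_of_L1 g hgm (Eventually.of_forall hfi)
  have hsum : ∀ k, Integrable (fun x => D k x + E x) μ := fun k => (hD k).add hE
  have hGk : ∀ k, ∫⁻ x, ENNReal.ofReal (D k x + E x) ∂μ = ENNReal.ofReal (∫ x, (D k x + E x) ∂μ) := by
    intro k
    rw [ofReal_integral_eq_lintegral_ofReal (hsum k)]
    filter_upwards [hbound k, hgE] with x h1 h2
    have := abs_nonneg (f k x); have := abs_nonneg (g x)
    simp only [Pi.zero_apply]; linarith
  have hG : Tendsto (fun k => ∫⁻ x, ENNReal.ofReal (D k x + E x) ∂μ) atTop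
      (𝓝 (∫⁻ x, ENNReal.ofReal (E x + E x) ∂μ)) := by
    have : ∫⁻ x, ENNReal.ofReal (E x + E x) ∂μ = ENNReal.ofReal (∫ x, (E x + E x) ∂μ) := by
      rw [ofReal_integral_eq_lintegral_ofReal (f := fun x => E x + E x) (hE.add hE)]
      filter_upwards [hgE] with x h2
      have := abs_nonneg (g x)
      simp only [Pi.zero_apply]; linarith
    rw [this]
    simp_rw [hGk]
    refine (ENNReal.continuous_ofReal.tendsto _).comp ?_
    simp_rw [fun k => integral_add (hD k) hE, integral_add hE hE]
    exact hint.add_const _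
  set N := ∫⁻ x, ENNReal.ofReal (E x + E x) ∂μ with hN
  have hNtop : N ≠ ⊤ := (hE.add hE).lintegral_lt_top.ne
  have hle : ∀ k, ∀ᵐ x ∂μ, ‖f k x - g x‖ₑ ≤ ENNReal.ofReal (D k x + E x) := by
    intro k
    filter_upwards [hbound k, hgE] with x h1 h2
    rw [← ofReal_norm]
    apply ENNReal.ofReal_le_ofReal
    exact (norm_sub_le _ _).trans (add_le_add h1 h2)
  have hsub : ∀ k, ∫⁻ x, (ENNReal.ofReal (D k x + E x) - ‖f k x - g x‖ₑ) ∂μ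
      = ∫⁻ x, ENNReal.ofReal (D k x + E x) ∂μ - ∫⁻ x, ‖f k x - g x‖ₑ ∂μ := by
    intro k
    refine lintegral_sub' ((hf k).sub hgm).enorm ?_ (hle k)
    exact ((hfi k).sub hg).hasFiniteIntegral.ne
  -- Fatou's lemma is applied to the non-negative functions $D_k+E-|f_k-g|$, which tend to $2E$. As
  -- $\int(D_k+E)\to\int 2E<\infty$, this forces $\int|f_k-g|\to0$.
  have fatou : N ≤ liminf (fun k => ∫⁻ x, ENNReal.ofReal (D k x + E x) ∂μ
      - ∫⁻ x, ‖f k x - g x‖ₑ ∂μ) atTop := by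
    simp_rw [← hsub]
    refine le_trans ?_ (lintegral_liminf_le' fun k =>
      ((hsum k).aestronglyMeasurable.aemeasurable.ennreal_ofReal.sub ((hf k).sub hgm).enorm))
    apply le_of_eq
    apply lintegral_congr_ae
    filter_upwards [hfg, hDE] with x h1 h2
    have : Tendsto (fun k => ENNReal.ofReal (D k x + E x) - ‖f k x - g x‖ₑ) atTop
        (𝓝 (ENNReal.ofReal (E x + E x) - 0)) := by
      refine ENNReal.Tendsto.sub ((ENNReal.continuous_ofReal.tendsto _).comp (h2.add_const _)) ?_
        (Or.inl ENNReal.ofReal_ne_top)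
      have := (h1.sub_const (g x)).enorm
      simpa using this
    rw [this.liminf_eq, tsub_zero]
  have hT : Tendsto (fun k => ∫⁻ x, ENNReal.ofReal (D k x + E x) ∂μ
      - ∫⁻ x, ‖f k x - g x‖ₑ ∂μ) atTop (𝓝 N) := by
    refine tendsto_of_le_liminf_of_limsup_le fatou ?_
    refine (limsup_le_limsup (Eventually.of_forall fun k => tsub_le_self)).trans ?_
    rw [hG.limsup_eq]
  have := ENNReal.Tendsto.sub hG hT (Or.inl hNtop)
  rw [tsub_self] at this
  refine this.congr fun k => ?_
  refine ENNReal.sub_sub_cancel (hsum k).lintegral_lt_top.ne ?_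
  exact lintegral_mono_ae (hle k)

/-! ### Mollification -/

variable {X : Type*} [NormedAddCommGroup X] [NormedSpace ℝ X]

/-- A family of bump functions whose supports shrink to the origin. -/
noncomputable def shrinkingBump (X : Type*) [NormedAddCommGroup X] [NormedSpace ℝ X]
    (r : ℝ) (hr : 0 < r) (k : ℕ) : ContDiffBump (0 : X) where
  rIn := r / (k + 1) / 2
  rOut := r / (k + 1)
  rIn_pos := by positivity
  rIn_lt_rOut := half_lt_self (by positivity)

theorem tendsto_rOut_shrinkingBump (r : ℝ) (hr : 0 < r) :
    Tendsto (fun k => (shrinkingBump X r hr k).rOut) atTop (𝓝 0) := by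
  have := (tendsto_one_div_add_atTop_nhds_zero_nat (𝕜 := ℝ)).const_mul r
  simpa [shrinkingBump, div_eq_mul_inv] using this

theorem rOut_shrinkingBump_le (r : ℝ) (hr : 0 < r) (k : ℕ) :
    (shrinkingBump X r hr k).rOut ≤ r := by
  apply div_le_self hr.le
  have : (0 : ℝ) ≤ k := k.cast_nonneg
  linarith

variable [FiniteDimensional ℝ X] [MeasurableSpace X] [BorelSpace X]

/-- Convolution with a normalised smooth bump function. -/
noncomputable def mollify (μ : Measure X) (φ : ContDiffBump (0 : X)) (g : X → ℝ) : X → ℝ :=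
  φ.normed μ ⋆[ContinuousLinearMap.lsmul ℝ ℝ, μ] g

variable {μ : Measure X} [μ.IsAddHaarMeasure]

theorem mollify_apply (φ : ContDiffBump (0 : X)) (g : X → ℝ) (z : X) :
    mollify μ φ g z = ∫ y, φ.normed μ (z - y) * g y ∂μ := by
  simp [mollify, convolution_eq_swap]

theorem integrable_bump_mul (φ : ContDiffBump (0 : X)) {g : X → ℝ} (hg : Integrable g μ) (z : X) :
    Integrable (fun y => φ.normed μ (z - y) * g y) μ := by
  have hc : Continuous (fun y => φ.normed μ (z - y)) :=
    φ.continuous_normed.comp (continuous_const.sub continuous_id)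
  obtain ⟨C, hC⟩ := φ.continuous_normed.bounded_above_of_compact_support
    (φ.hasCompactSupport_normed (μ := μ))
  exact hg.bdd_mul hc.aestronglyMeasurable (Eventually.of_forall fun y => hC (z - y))

theorem integral_bump_sub (φ : ContDiffBump (0 : X)) (z : X) :
    ∫ y, φ.normed μ (z - y) ∂μ = 1 := by
  rw [integral_sub_left_eq_self (fun y => φ.normed μ y) μ z, φ.integral_normed]

theorem integrable_bump_sub (φ : ContDiffBump (0 : X)) (z : X) :
    Integrable (fun y => φ.normed μ (z - y)) μ :=
  φ.integrable_normed.comp_sub_left z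

theorem mollify_nonneg (φ : ContDiffBump (0 : X)) {g : X → ℝ} (hg : ∀ᵐ y ∂μ, 0 ≤ g y) (z : X) :
    0 ≤ mollify μ φ g z := by
  rw [mollify_apply]
  apply integral_nonneg_of_ae
  filter_upwards [hg] with y hy
  exact mul_nonneg (φ.nonneg_normed _) hy

/-- Jensen's inequality for the probability density $y\mapsto\varphi(z-y)$, in the form that a
variance is non-negative. It supplies the dominating functions for products of mollified gradients.
-/
theorem sq_mollify_le (φ : ContDiffBump (0 : X)) {g : X → ℝ} (hg : Integrable g μ)
    (hg2 : Integrable (fun y => g y ^ 2) μ) (z : X) :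
    mollify μ φ g z ^ 2 ≤ mollify μ φ (fun y => g y ^ 2) z := by
  set c := mollify μ φ g z with hc
  have h0 : 0 ≤ ∫ y, φ.normed μ (z - y) * (g y - c) ^ 2 ∂μ :=
    integral_nonneg fun y => mul_nonneg (φ.nonneg_normed _) (sq_nonneg _)
  have h1 : ∫ y, φ.normed μ (z - y) * (g y - c) ^ 2 ∂μ
      = mollify μ φ (fun y => g y ^ 2) z - 2 * c * c + c ^ 2 := by
    have e : ∀ y, φ.normed μ (z - y) * (g y - c) ^ 2 = φ.normed μ (z - y) * g y ^ 2
        - 2 * c * (φ.normed μ (z - y) * g y) + c ^ 2 * φ.normed μ (z - y) := fun y => by ring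
    simp_rw [e]
    have i1 := integrable_bump_mul φ hg2 z
    have i2 := (integrable_bump_mul φ hg z).const_mul (2 * c)
    rw [integral_add (f := fun y => _ - _) (i1.sub i2) ((integrable_bump_sub φ z).const_mul _), integral_sub i1 i2,
      integral_const_mul, integral_const_mul, integral_bump_sub, mollify_apply]
    rw [hc, mollify_apply, mul_one]
  nlinarith

theorem integrable_mollify (φ : ContDiffBump (0 : X)) {g : X → ℝ} (hg : Integrable g μ) :
    Integrable (mollify μ φ g) μ :=
  φ.integrable_normed.integrable_convolution _ hg

theorem integral_mollify (φ : ContDiffBump (0 : X)) {g : X → ℝ} (hg : Integrable g μ) :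
    ∫ z, mollify μ φ g z ∂μ = ∫ z, g z ∂μ := by
  rw [mollify, integral_convolution _ φ.integrable_normed hg, φ.integral_normed]
  simp

theorem contDiff_mollify (φ : ContDiffBump (0 : X)) {g : X → ℝ} (hg : Integrable g μ) :
    ContDiff ℝ ∞ (mollify μ φ g) :=
  (φ.hasCompactSupport_normed).contDiff_convolution_left _ φ.contDiff_normed hg.locallyIntegrable

theorem fderiv_mollify (φ : ContDiffBump (0 : X)) {g : X → ℝ} (hg : Integrable g μ) (z w : X) :
    fderiv ℝ (mollify μ φ g) z w = ∫ y, fderiv ℝ (φ.normed μ) (z - y) w * g y ∂μ := by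
  have hcs := φ.hasCompactSupport_normed (μ := μ)
  have hcd : ContDiff ℝ 1 (φ.normed μ) := φ.contDiff_normed
  have h := (hcs.hasFDerivAt_convolution_left (ContinuousLinearMap.lsmul ℝ ℝ) hcd
    hg.locallyIntegrable z)
  have hex : ConvolutionExists (fderiv ℝ (φ.normed μ)) g
      ((ContinuousLinearMap.lsmul ℝ ℝ).precompL X) μ :=
    (hcs.fderiv ℝ).convolutionExists_left _ (hcd.continuous_fderiv (by norm_num))
      hg.locallyIntegrable
  rw [mollify, h.fderiv, convolution_eq_swap, ContinuousLinearMap.integral_apply]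
  · rfl
  · exact (hex z).integrable_swap

theorem ae_tendsto_mollify (r : ℝ) (hr : 0 < r) {g : X → ℝ} (hg : Integrable g μ) :
    ∀ᵐ z ∂μ, Tendsto (fun k => mollify μ (shrinkingBump X r hr k) g z) atTop (𝓝 (g z)) := by
  -- Lebesgue differentiation needs a bounded ratio of outer to inner radius; here it is exactly 2.
  refine ContDiffBump.ae_convolution_tendsto_right_of_locallyIntegrable (K := 2)
    (tendsto_rOut_shrinkingBump r hr) (Eventually.of_forall fun k => ?_) hg.locallyIntegrable
  simp only [shrinkingBump]
  linarith

/-- Dominated convergence with the mollifications of a fixed integrable function as bounds. -/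
theorem tendsto_integral_of_le_mollify (r : ℝ) (hr : 0 < r) {f : ℕ → X → ℝ} {g w q : X → ℝ}
    (hf : ∀ k, AEStronglyMeasurable (f k) μ) (hw : Integrable w μ) (hq : Integrable q μ)
    (hbound : ∀ k x, |f k x| ≤ mollify μ (shrinkingBump X r hr k) w x + q x)
    (hfg : ∀ᵐ x ∂μ, Tendsto (fun k => f k x) atTop (𝓝 (g x))) :
    Integrable g μ ∧ Tendsto (fun k => ∫ x, f k x ∂μ) atTop (𝓝 (∫ x, g x ∂μ)) := by
  refine tendsto_integral_of_pratt hf (fun k => (integrable_mollify _ hw).add hq) (hw.add hq)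
    (fun k => Eventually.of_forall (hbound k)) hfg ?_ ?_
  · filter_upwards [ae_tendsto_mollify r hr hw] with x hx
    exact hx.add_const _
  · simp_rw [fun k => integral_add' (integrable_mollify (shrinkingBump X r hr k) hw) hq,
      integral_add' hw hq, fun k => integral_mollify (shrinkingBump X r hr k) hw]
    exact tendsto_const_nhds

/-! ### Weak directional derivatives and nonlinear test functions -/

section WeakDerivatives

set_option linter.unusedSectionVars false

variable {X : Type*} [NormedAddCommGroup X] [NormedSpace ℝ X] [FiniteDimensional ℝ X]
  [MeasurableSpace X] [BorelSpace X] {μ : Measure X} [μ.IsAddHaarMeasure]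

theorem mollify_const_mul (φ : ContDiffBump (0 : X)) (c : ℝ) (g : X → ℝ) (z : X) :
    mollify μ φ (fun y => c * g y) z = c * mollify μ φ g z := by
  simp_rw [mollify_apply, ← integral_const_mul]
  congr 1; ext y; ring

theorem mollify_add (φ : ContDiffBump (0 : X)) {g h : X → ℝ} (hg : Integrable g μ)
    (hh : Integrable h μ) (z : X) :
    mollify μ φ (fun y => g y + h y) z = mollify μ φ g z + mollify μ φ h z := by
  simp_rw [mollify_apply, mul_add]
  exact integral_add (integrable_bump_mul φ hg z) (integrable_bump_mul φ hh z)

/-- `d` is the weak derivative of `v` in the direction `w` in the set `W`. -/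
def IsWeakLineDeriv (μ : Measure X) (W : Set X) (v d : X → ℝ) (w : X) : Prop :=
  ∀ φ : X → ℝ, IsTestFunction W φ → ∫ z, v z * fderiv ℝ φ z w ∂μ = - ∫ z, φ z * d z ∂μ

theorem isTestFunction_bump_sub (φ : ContDiffBump (0 : X)) {z : X} {W : Set X}
    (h : Metric.closedBall z φ.rOut ⊆ W) : IsTestFunction W (fun y => φ.normed μ (z - y)) where
  contDiff := φ.contDiff_normed.comp (contDiff_const.sub contDiff_id)
  hasCompactSupport := (φ.hasCompactSupport_normed (μ := μ)).comp_homeomorph (Homeomorph.subLeft z)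
  tsupport_subset := by
    refine Subset.trans (closure_minimal ?_ Metric.isClosed_closedBall) h
    intro y hy
    have : z - y ∈ Function.support (φ.normed μ) := hy
    rw [φ.support_normed_eq, Metric.mem_ball, dist_zero_right] at this
    rw [Metric.mem_closedBall, dist_comm, dist_eq_norm]
    exact this.le

theorem fderiv_bump_sub (φ : ContDiffBump (0 : X)) (z y w : X) :
    fderiv ℝ (fun y => φ.normed μ (z - y)) y w = - fderiv ℝ (φ.normed μ) (z - y) w := by
  have h1 : HasFDerivAt (φ.normed μ) (fderiv ℝ (φ.normed μ) (z - y)) (z - y) :=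
    ((φ.contDiff_normed (n := 1)).differentiable (by norm_num) _).hasFDerivAt
  have h2 : HasFDerivAt (fun y => z - y) (-ContinuousLinearMap.id ℝ X) y := by
    simpa using (hasFDerivAt_id y).const_sub z
  have := (h1.comp y h2).fderiv
  simp only [Function.comp_def] at this
  rw [this]; simp

/-- The reflected kernel $y\mapsto\varphi(z-y)$ is itself an admissible test function as long as its
support ball lies in `W`. The identity is therefore available only at such `z`. -/
theorem IsWeakLineDeriv.fderiv_mollify {W : Set X} {v d : X → ℝ} {w z : X}
    (h : IsWeakLineDeriv μ W v d w) (hv : Integrable v μ) (φ : ContDiffBump (0 : X))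
    (hz : Metric.closedBall z φ.rOut ⊆ W) :
    fderiv ℝ (mollify μ φ v) z w = mollify μ φ d z := by
  have := h _ (isTestFunction_bump_sub (μ := μ) φ hz)
  rw [PME.fderiv_mollify φ hv, mollify_apply, ← neg_inj, ← this, ← integral_neg]
  congr 1; ext y
  rw [fderiv_bump_sub]; ring

theorem integrable_fderiv_bump_mul (φ : ContDiffBump (0 : X)) {g : X → ℝ} (hg : Integrable g μ)
    (z w : X) : Integrable (fun y => fderiv ℝ (φ.normed μ) (z - y) w * g y) μ := by
  have hc0 : Continuous (fun y => fderiv ℝ (φ.normed μ) y w) :=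
    ((φ.contDiff_normed (n := 1)).continuous_fderiv (by norm_num)).clm_apply continuous_const
  have hc : Continuous (fun y => fderiv ℝ (φ.normed μ) (z - y) w) :=
    hc0.comp (continuous_const.sub continuous_id)
  have hs : HasCompactSupport (fun y => fderiv ℝ (φ.normed μ) y w) :=
    (φ.hasCompactSupport_normed (μ := μ)).fderiv_apply ℝ w
  obtain ⟨C, hC⟩ := hc0.bounded_above_of_compact_support hs
  exact hg.bdd_mul hc.aestronglyMeasurable (Eventually.of_forall fun y => hC (z - y))

/-- Testing with the reflected kernel, which is non-negative, makes the weak inequality a classical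
one at `z`. The sign flips because $\partial_y\varphi(z-y)=-(\partial\varphi)(z-y)$. -/
theorem mollify_supersolution {ι : Type*} [Fintype ι] {W : Set X} {u : X → ℝ} {g : ι → X → ℝ}
    {τ : X} {e : ι → X} (hu : Integrable u μ) (hg : ∀ i, Integrable (g i) μ)
    (h : ∀ φ : X → ℝ, IsTestFunction W φ → (∀ z, 0 ≤ φ z) →
      0 ≤ ∫ z, (-(u z * fderiv ℝ φ z τ) + ∑ i, g i z * fderiv ℝ φ z (e i)) ∂μ)
    (φ : ContDiffBump (0 : X)) {z : X} (hz : Metric.closedBall z φ.rOut ⊆ W) :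
    0 ≤ fderiv ℝ (mollify μ φ u) z τ - ∑ i, fderiv ℝ (mollify μ φ (g i)) z (e i) := by
  have := h _ (isTestFunction_bump_sub (μ := μ) φ hz) (fun y => φ.nonneg_normed _)
  rw [fderiv_mollify φ hu]
  simp_rw [fun i => fderiv_mollify φ (hg i)]
  rw [← integral_finsetSum _ (fun i _ => integrable_fderiv_bump_mul φ (hg i) z (e i)),
    ← integral_sub (integrable_fderiv_bump_mul φ hu z τ)
      (integrable_finsetSum _ (fun i _ => integrable_fderiv_bump_mul φ (hg i) z (e i)))]
  refine this.trans_eq ?_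
  congr 1; ext y
  simp_rw [fderiv_bump_sub, mul_neg, Finset.sum_neg_distrib]
  simp only [mul_comm]
  ring

/-- The nonlinearities are powers, well behaved only on $[0,\infty)$; this suffices because
mollifications of non-negative functions are non-negative everywhere. -/
theorem contDiff_one_comp_of_nonneg {b b' : ℝ → ℝ} (hb : ∀ s, 0 ≤ s → HasDerivAt b (b' s) s)
    (hb' : ContinuousOn b' (Ici 0)) {v : X → ℝ} (hv : ContDiff ℝ 1 v) (hv0 : ∀ z, 0 ≤ v z) :
    ContDiff ℝ 1 (fun z => b (v z)) ∧
      ∀ z, fderiv ℝ (fun z => b (v z)) z = b' (v z) • fderiv ℝ v z := by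
  have h : ∀ z, HasFDerivAt (fun z => b (v z)) (b' (v z) • fderiv ℝ v z) z := fun z =>
    (hb _ (hv0 z)).comp_hasFDerivAt z (hv.differentiable (by norm_num) z).hasFDerivAt
  refine ⟨contDiff_one_iff_fderiv.2 ⟨fun z => (h z).differentiableAt, ?_⟩, fun z => (h z).fderiv⟩
  rw [show fderiv ℝ (fun z => b (v z)) = fun z => b' (v z) • fderiv ℝ v z from
    funext fun z => (h z).fderiv]
  exact (hb'.comp_continuous hv.continuous hv0).smul (hv.continuous_fderiv (by norm_num))

theorem integral_mul_fderiv_of_hasCompactSupport {a η : X → ℝ} (ha : ContDiff ℝ 1 a)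
    (hη : ContDiff ℝ 1 η) (hs : HasCompactSupport η) (w : X) :
    ∫ z, a z * fderiv ℝ η z w ∂μ = - ∫ z, fderiv ℝ a z w * η z ∂μ := by
  have ca : Continuous fun z => fderiv ℝ a z w :=
    (ha.continuous_fderiv (by norm_num)).clm_apply continuous_const
  have cη : Continuous fun z => fderiv ℝ η z w :=
    (hη.continuous_fderiv (by norm_num)).clm_apply continuous_const
  refine integral_mul_fderiv_eq_neg_fderiv_mul_of_integrable ?_ ?_ ?_
    (fun z _ => ha.differentiable (by norm_num) z) (fun z _ => hη.differentiable (by norm_num) z)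
  · exact (ca.mul hη.continuous).integrable_of_hasCompactSupport hs.mul_left
  · exact (ha.continuous.mul cη).integrable_of_hasCompactSupport (hs.fderiv_apply ℝ w).mul_left
  · exact (ha.continuous.mul hη.continuous).integrable_of_hasCompactSupport hs.mul_left

theorem IsTestFunction.bound_fderiv {W : Set X} {η : X → ℝ} (h : IsTestFunction W η) (w : X) :
    Integrable (fun z => fderiv ℝ η z w) μ ∧ (Continuous fun z => fderiv ℝ η z w) ∧
      ∃ M, 0 ≤ M ∧ ∀ z, |fderiv ℝ η z w| ≤ M := by
  have c : Continuous fun z => fderiv ℝ η z w :=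
    (h.contDiff.continuous_fderiv (by simp)).clm_apply continuous_const
  have hs : HasCompactSupport fun z => fderiv ℝ η z w := h.hasCompactSupport.fderiv_apply ℝ w
  obtain ⟨M, hM⟩ := c.bounded_above_of_compact_support hs
  exact ⟨c.integrable_of_hasCompactSupport hs, c, M, (norm_nonneg _).trans (hM 0), hM⟩

theorem IsTestFunction.bound {W : Set X} {η : X → ℝ} (h : IsTestFunction W η) :
    Integrable η μ ∧ ∃ M, 0 ≤ M ∧ ∀ z, |η z| ≤ M := by
  have c : Continuous η := h.contDiff.continuous
  obtain ⟨M, hM⟩ := c.bounded_above_of_compact_support h.hasCompactSupport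
  exact ⟨c.integrable_of_hasCompactSupport h.hasCompactSupport, M, (norm_nonneg _).trans (hM 0), hM⟩

/-- One radius serves the whole support, so every mollification at a smaller scale respects the weak
identities wherever `η` is non-zero. -/
theorem IsTestFunction.exists_radius {W : Set X} (hW : IsOpen W) {η : X → ℝ}
    (h : IsTestFunction W η) :
    ∃ r, 0 < r ∧ ∀ z ∈ tsupport η, Metric.closedBall z r ⊆ W := by
  obtain ⟨r, hr, hrW⟩ := h.hasCompactSupport.isCompact.exists_cthickening_subset_open hW
    h.tsupport_subset
  exact ⟨r, hr, fun z hz => (Metric.closedBall_subset_cthickening hz r).trans hrW⟩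

theorem tendsto_comp_of_nonneg {b : ℝ → ℝ} (hb : ContinuousOn b (Ici 0)) {s : ℕ → ℝ} {t : ℝ}
    (hs : ∀ k, 0 ≤ s k) (ht : Tendsto s atTop (𝓝 t)) (ht0 : 0 ≤ t) :
    Tendsto (fun k => b (s k)) atTop (𝓝 (b t)) :=
  (hb t ht0).tendsto.comp (tendsto_nhdsWithin_iff.2 ⟨ht, Eventually.of_forall hs⟩)

/-- Limit of the mollified integrals `∫ b(v_k) ψ`. -/
theorem tendsto_integral_comp_mollify (r : ℝ) (hr : 0 < r) {v : X → ℝ} (hv : Integrable v μ)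
    (hv0 : ∀ᵐ z ∂μ, 0 ≤ v z) {b : ℝ → ℝ} {C : ℝ} (hb : ContinuousOn b (Ici 0))
    (hbC : ∀ s, 0 ≤ s → |b s| ≤ C * (1 + s)) {ψ : X → ℝ} (hψ : Continuous ψ)
    (hψi : Integrable ψ μ) {M : ℝ} (hM : ∀ z, |ψ z| ≤ M) :
    Integrable (fun z => b (v z) * ψ z) μ ∧
    Tendsto (fun k => ∫ z, b (mollify μ (shrinkingBump X r hr k) v z) * ψ z ∂μ) atTop
      (𝓝 (∫ z, b (v z) * ψ z ∂μ)) := by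
  have hC : 0 ≤ C := by simpa using (abs_nonneg _).trans (hbC 0 le_rfl)
  refine tendsto_integral_of_le_mollify r hr (w := fun z => (C * M) * v z)
    (q := fun z => C * |ψ z|) (fun k => ?_) (hv.const_mul _) (hψi.abs.const_mul _)
    (fun k z => ?_) ?_
  · exact ((hb.comp_continuous (contDiff_mollify _ hv).continuous
      (mollify_nonneg _ hv0)).mul hψ).aestronglyMeasurable
  · have h0 := mollify_nonneg (shrinkingBump X r hr k) hv0 z
    rw [mollify_const_mul, abs_mul]
    calc _ ≤ C * (1 + mollify μ (shrinkingBump X r hr k) v z) * |ψ z| := by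
          gcongr; exact hbC _ h0
      _ = C * mollify μ (shrinkingBump X r hr k) v z * |ψ z| + C * |ψ z| := by ring
      _ ≤ C * mollify μ (shrinkingBump X r hr k) v z * M + C * |ψ z| := by
          gcongr; exact hM z
      _ = _ := by ring
  · filter_upwards [ae_tendsto_mollify r hr hv, hv0] with z hz h0
    exact (tendsto_comp_of_nonneg hb (fun k => mollify_nonneg _ hv0 z) hz h0).mul_const _

/-- Limit of the mollified integrals `∫ b(v_k) d_k ψ`. -/
theorem tendsto_integral_comp_mollify_mul (r : ℝ) (hr : 0 < r) {v d : X → ℝ} (hv : Integrable v μ)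
    (hv0 : ∀ᵐ z ∂μ, 0 ≤ v z) (hd : Integrable d μ) (hd2 : Integrable (fun z => d z ^ 2) μ)
    {b : ℝ → ℝ} {C : ℝ} (hb : ContinuousOn b (Ici 0))
    (hbC : ∀ s, 0 ≤ s → |b s| ≤ C) {ψ : X → ℝ} (hψ : Continuous ψ)
    (hψi : Integrable ψ μ) {M : ℝ} (hM : ∀ z, |ψ z| ≤ M) :
    Integrable (fun z => b (v z) * d z * ψ z) μ ∧
    Tendsto (fun k => ∫ z, b (mollify μ (shrinkingBump X r hr k) v z) *
      mollify μ (shrinkingBump X r hr k) d z * ψ z ∂μ) atTop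
      (𝓝 (∫ z, b (v z) * d z * ψ z ∂μ)) := by
  have hC : 0 ≤ C := by simpa using (abs_nonneg _).trans (hbC 0 le_rfl)
  refine tendsto_integral_of_le_mollify r hr (w := fun z => (C * M) * d z ^ 2)
    (q := fun z => C * |ψ z|) (fun k => ?_) (hd2.const_mul _) (hψi.abs.const_mul _)
    (fun k z => ?_) ?_
  · exact (((hb.comp_continuous (contDiff_mollify _ hv).continuous
      (mollify_nonneg _ hv0)).mul (contDiff_mollify _ hd).continuous).mul hψ).aestronglyMeasurable
  · have h0 := mollify_nonneg (shrinkingBump X r hr k) hv0 z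
    have h1 := sq_mollify_le (shrinkingBump X r hr k) hd hd2 z
    set D := mollify μ (shrinkingBump X r hr k) d z
    rw [mollify_const_mul, abs_mul, abs_mul]
    -- The linear factor is traded for its square, which Jensen's inequality bounds by a
    -- mollification; the extra 1 is paid for by the integrable `ψ`.
    have h2 : |D| ≤ D ^ 2 + 1 := by
      rw [← sq_abs]; nlinarith [sq_nonneg (|D| - 1 / 2)]
    calc _ ≤ C * (D ^ 2 + 1) * |ψ z| := by
          gcongr; exact hbC _ h0
      _ = C * D ^ 2 * |ψ z| + C * |ψ z| := by ring
      _ ≤ C * mollify μ (shrinkingBump X r hr k) (fun z => d z ^ 2) z * M + C * |ψ z| := by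
          have := (sq_nonneg D).trans h1
          gcongr; exact hM z
      _ = _ := by ring
  · filter_upwards [ae_tendsto_mollify r hr hv, hv0, ae_tendsto_mollify r hr hd] with z hz h0 hdz
    exact ((tendsto_comp_of_nonneg hb (fun k => mollify_nonneg _ hv0 z) hz h0).mul hdz).mul_const _

/-- Limit of the mollified integrals `∫ b(v_k) d_k g_k ψ`. -/
theorem tendsto_integral_comp_mollify_mul_mul (r : ℝ) (hr : 0 < r) {v d g : X → ℝ}
    (hv : Integrable v μ) (hv0 : ∀ᵐ z ∂μ, 0 ≤ v z)
    (hd : Integrable d μ) (hd2 : Integrable (fun z => d z ^ 2) μ)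
    (hg : Integrable g μ) (hg2 : Integrable (fun z => g z ^ 2) μ)
    {b : ℝ → ℝ} {C : ℝ} (hb : ContinuousOn b (Ici 0))
    (hbC : ∀ s, 0 ≤ s → |b s| ≤ C) {ψ : X → ℝ} (hψ : Continuous ψ) {M : ℝ} (hM : ∀ z, |ψ z| ≤ M) :
    Integrable (fun z => b (v z) * d z * g z * ψ z) μ ∧
    Tendsto (fun k => ∫ z, b (mollify μ (shrinkingBump X r hr k) v z) *
      mollify μ (shrinkingBump X r hr k) d z * mollify μ (shrinkingBump X r hr k) g z * ψ z ∂μ) atTop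
      (𝓝 (∫ z, b (v z) * d z * g z * ψ z ∂μ)) := by
  have hC : 0 ≤ C := by simpa using (abs_nonneg _).trans (hbC 0 le_rfl)
  refine tendsto_integral_of_le_mollify r hr (w := fun z => (C * M) * (d z ^ 2 + g z ^ 2))
    (q := fun _ => 0) (fun k => ?_) ((hd2.add hg2).const_mul _) (integrable_zero _ _ _)
    (fun k z => ?_) ?_
  · exact ((((hb.comp_continuous (contDiff_mollify _ hv).continuous
      (mollify_nonneg _ hv0)).mul (contDiff_mollify _ hd).continuous).mul
      (contDiff_mollify _ hg).continuous).mul hψ).aestronglyMeasurable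
  · have h0 := mollify_nonneg (shrinkingBump X r hr k) hv0 z
    have h1 := sq_mollify_le (shrinkingBump X r hr k) hd hd2 z
    have h3 := sq_mollify_le (shrinkingBump X r hr k) hg hg2 z
    rw [mollify_const_mul, mollify_add _ hd2 hg2, abs_mul, abs_mul, abs_mul, add_zero]
    set D := mollify μ (shrinkingBump X r hr k) d z
    set G := mollify μ (shrinkingBump X r hr k) g z
    have h2 : |D| * |G| ≤ D ^ 2 + G ^ 2 := by
      rw [← sq_abs D, ← sq_abs G]; nlinarith [sq_nonneg (|D| - |G|), sq_nonneg (|D| + |G|)]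
    calc _ = |b (mollify μ (shrinkingBump X r hr k) v z)| * (|D| * |G|) * |ψ z| := by ring
      _ ≤ C * (D ^ 2 + G ^ 2) * M := by
          have := hM z
          gcongr; exact hbC _ h0
      _ ≤ C * (mollify μ (shrinkingBump X r hr k) (fun z => d z ^ 2) z +
          mollify μ (shrinkingBump X r hr k) (fun z => g z ^ 2) z) * M := by
          have := (abs_nonneg _).trans (hM z)
          gcongr
      _ = _ := by ring
  · filter_upwards [ae_tendsto_mollify r hr hv, hv0, ae_tendsto_mollify r hr hd,
      ae_tendsto_mollify r hr hg] with z hz h0 hdz hgz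
    exact (((tendsto_comp_of_nonneg hb (fun k => mollify_nonneg _ hv0 z) hz h0).mul hdz).mul
      hgz).mul_const _

/-- The chain rule for weak derivatives of non-negative functions. -/
theorem IsWeakLineDeriv.comp_of_nonneg {W : Set X} (hW : IsOpen W) {v d : X → ℝ} {w : X}
    (h : IsWeakLineDeriv μ W v d w) (hv : Integrable v μ) (hv0 : ∀ᵐ z ∂μ, 0 ≤ v z)
    (hd : Integrable d μ) (hd2 : Integrable (fun z => d z ^ 2) μ)
    {b b' : ℝ → ℝ} {C : ℝ} (hb : ∀ s, 0 ≤ s → HasDerivAt b (b' s) s)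
    (hb' : ContinuousOn b' (Ici 0)) (hbC : ∀ s, 0 ≤ s → |b s| ≤ C * (1 + s))
    (hbC' : ∀ s, 0 ≤ s → |b' s| ≤ C) :
    IsWeakLineDeriv μ W (fun z => b (v z)) (fun z => b' (v z) * d z) w := by
  intro η hη
  obtain ⟨r, hr, hrW⟩ := hη.exists_radius hW
  obtain ⟨hDi, hDc, M, hM0, hM⟩ := hη.bound_fderiv (μ := μ) w
  obtain ⟨hηi, M', hM0', hM'⟩ := hη.bound (μ := μ)
  have hbc : ContinuousOn b (Ici 0) := fun s hs => (hb s hs).continuousAt.continuousWithinAt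
  have t1 := (tendsto_integral_comp_mollify r hr hv hv0 hbc hbC hDc hDi hM).2
  have t2 := (tendsto_integral_comp_mollify_mul r hr hv hv0 hd hd2 hb' hbC' hη.contDiff.continuous
    hηi hM').2
  simp_rw [mul_comm (η _)]
  -- Both sides are limits of integrals that agree for every `k`, by classical integration by parts.
  refine tendsto_nhds_unique t1 (t2.neg.congr fun k => ?_)
  set φ := shrinkingBump X r hr k
  have hc := contDiff_one_comp_of_nonneg hb hb' ((contDiff_mollify φ hv).of_le (by simp))
    (mollify_nonneg φ hv0)
  rw [integral_mul_fderiv_of_hasCompactSupport hc.1 (hη.contDiff.of_le (by simp))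
    hη.hasCompactSupport]
  congr 2; ext z
  by_cases hz : z ∈ tsupport η
  · rw [hc.2 z, ← h.fderiv_mollify hv φ
      ((Metric.closedBall_subset_closedBall (rOut_shrinkingBump_le r hr k)).trans (hrW z hz))]
    simp
  · rw [image_eq_zero_of_notMem_tsupport hz, mul_zero, mul_zero]

/-- Testing the supersolution inequality with `f(u) η`, where `f = F'`. -/
theorem supersolution_test_comp {ι : Type*} [Fintype ι] {W : Set X} (hW : IsOpen W) {u : X → ℝ}
    {d g : ι → X → ℝ} {τ : X} {e : ι → X} (hu : Integrable u μ) (hu0 : ∀ᵐ z ∂μ, 0 ≤ u z)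
    (hd : ∀ i, Integrable (d i) μ) (hd2 : ∀ i, Integrable (fun z => d i z ^ 2) μ)
    (hg : ∀ i, Integrable (g i) μ) (hg2 : ∀ i, Integrable (fun z => g i z ^ 2) μ)
    (hweak : ∀ i, IsWeakLineDeriv μ W u (d i) (e i))
    (hsuper : ∀ φ : X → ℝ, IsTestFunction W φ → (∀ z, 0 ≤ φ z) →
      0 ≤ ∫ z, (-(u z * fderiv ℝ φ z τ) + ∑ i, g i z * fderiv ℝ φ z (e i)) ∂μ)
    {F f f' : ℝ → ℝ} {C : ℝ} (hF : ∀ s, 0 ≤ s → HasDerivAt F (f s) s)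
    (hf : ∀ s, 0 ≤ s → HasDerivAt f (f' s) s) (hf' : ContinuousOn f' (Ici 0))
    (hFC : ∀ s, 0 ≤ s → |F s| ≤ C * (1 + s)) (hf0 : ∀ s, 0 ≤ s → 0 ≤ f s)
    (hfC : ∀ s, 0 ≤ s → |f s| ≤ C) (hfC' : ∀ s, 0 ≤ s → |f' s| ≤ C)
    {η : X → ℝ} (hη : IsTestFunction W η) (hη0 : ∀ z, 0 ≤ η z) :
    Integrable (fun z => F (u z) * fderiv ℝ η z τ) μ ∧
    (∀ i, Integrable (fun z => f' (u z) * d i z * g i z * η z) μ) ∧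
    (∀ i, Integrable (fun z => f (u z) * g i z * fderiv ℝ η z (e i)) μ) ∧
    0 ≤ - ∫ z, F (u z) * fderiv ℝ η z τ ∂μ +
      ∑ i, (∫ z, f' (u z) * d i z * g i z * η z ∂μ +
        ∫ z, f (u z) * g i z * fderiv ℝ η z (e i) ∂μ) := by
  obtain ⟨r, hr, hrW⟩ := hη.exists_radius hW
  obtain ⟨hDi, hDc, M, hM0, hM⟩ := hη.bound_fderiv (μ := μ) τ
  obtain ⟨hηi, M', hM0', hM'⟩ := hη.bound (μ := μ)
  have hFc : ContinuousOn F (Ici 0) := fun s hs => (hF s hs).continuousAt.continuousWithinAt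
  have hfc : ContinuousOn f (Ici 0) := fun s hs => (hf s hs).continuousAt.continuousWithinAt
  have t1 := tendsto_integral_comp_mollify r hr hu hu0 hFc hFC hDc hDi hM
  have t2 := fun i => tendsto_integral_comp_mollify_mul_mul r hr hu hu0 (hd i) (hd2 i) (hg i) (hg2 i)
    hf' hfC' hη.contDiff.continuous hM'
  have t3 := fun i => tendsto_integral_comp_mollify_mul r hr hu hu0 (hg i) (hg2 i)
    hfc hfC (hη.bound_fderiv (μ := μ) (e i)).2.1 (hη.bound_fderiv (μ := μ) (e i)).1
    (hη.bound_fderiv (μ := μ) (e i)).2.2.choose_spec.2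
  refine ⟨t1.1, fun i => (t2 i).1, fun i => (t3 i).1, ?_⟩
  have t := t1.2.neg.add (tendsto_finsetSum Finset.univ fun i _ => (t2 i).2.add (t3 i).2)
  refine ge_of_tendsto' t fun k => ?_
  set φ := shrinkingBump X r hr k
  have hball : ∀ z ∈ tsupport η, Metric.closedBall z φ.rOut ⊆ W := fun z hz =>
    (Metric.closedBall_subset_closedBall (rOut_shrinkingBump_le r hr k)).trans (hrW z hz)
  have hu1 : ContDiff ℝ 1 (mollify μ φ u) := (contDiff_mollify φ hu).of_le (by simp)
  have hg1 : ∀ i, ContDiff ℝ 1 (mollify μ φ (g i)) := fun i =>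
    (contDiff_mollify φ (hg i)).of_le (by simp)
  have hη1 : ContDiff ℝ 1 η := hη.contDiff.of_le (by simp)
  have hk0 := mollify_nonneg (μ := μ) φ hu0
  have hcF := contDiff_one_comp_of_nonneg hF hfc hu1 hk0
  have hcf := contDiff_one_comp_of_nonneg hf hf' hu1 hk0
  have hψ : ContDiff ℝ 1 (fun z => f (mollify μ φ u z) * η z) := hcf.1.mul hη1
  have hψs : HasCompactSupport (fun z => f (mollify μ φ u z) * η z) := hη.hasCompactSupport.mul_left
  -- Since `F' = f`, the time term is $\int \partial_\tau u_k\, f(u_k)\eta$; in the limit only `F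
  -- (u)` appears and no time derivative of `u` is needed.
  have e1 : - ∫ z, F (mollify μ φ u z) * fderiv ℝ η z τ ∂μ
      = ∫ z, fderiv ℝ (mollify μ φ u) z τ * (f (mollify μ φ u z) * η z) ∂μ := by
    rw [integral_mul_fderiv_of_hasCompactSupport hcF.1 hη1 hη.hasCompactSupport, neg_neg]
    congr 1; ext z
    rw [hcF.2 z]; simp; ring
  have e2 : ∀ i, (∫ z, f' (mollify μ φ u z) * mollify μ φ (d i) z * mollify μ φ (g i) z * η z ∂μ +
        ∫ z, f (mollify μ φ u z) * mollify μ φ (g i) z * fderiv ℝ η z (e i) ∂μ)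
      = - ∫ z, fderiv ℝ (mollify μ φ (g i)) z (e i) * (f (mollify μ φ u z) * η z) ∂μ := by
    intro i
    rw [← integral_mul_fderiv_of_hasCompactSupport (hg1 i) hψ hψs, ← integral_add]
    · congr 1; ext z
      have : fderiv ℝ (fun z => f (mollify μ φ u z) * η z) z
          = f (mollify μ φ u z) • fderiv ℝ η z + η z • (f' (mollify μ φ u z) •
            fderiv ℝ (mollify μ φ u) z) := by
        rw [fderiv_fun_mul (hcf.1.differentiable (by norm_num) z)
          (hη1.differentiable (by norm_num) z), hcf.2 z]
      rw [this]
      by_cases hz : z ∈ tsupport η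
      · rw [← (hweak i).fderiv_mollify hu φ (hball z hz)]
        simp; ring
      · rw [image_eq_zero_of_notMem_tsupport hz]
        simp; ring
    · refine Continuous.integrable_of_hasCompactSupport ?_ hη.hasCompactSupport.mul_left
      exact (((hf'.comp_continuous hu1.continuous hk0).mul (contDiff_mollify φ (hd i)).continuous).mul
        (hg1 i).continuous).mul hη1.continuous
    · refine Continuous.integrable_of_hasCompactSupport ?_
        (hη.hasCompactSupport.fderiv_apply ℝ (e i)).mul_left
      exact ((hfc.comp_continuous hu1.continuous hk0).mul (hg1 i).continuous).mul
        (hη.bound_fderiv (μ := μ) (e i)).2.1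
  have hint : ∀ (a : X → ℝ), ContDiff ℝ 1 a → ∀ w : X,
      Integrable (fun z => fderiv ℝ a z w * (f (mollify μ φ u z) * η z)) μ := fun a ha w =>
    (((ha.continuous_fderiv (by norm_num)).clm_apply continuous_const).mul
      hψ.continuous).integrable_of_hasCompactSupport hψs.mul_left
  -- The expression is now the integral of the pointwise inequality for the mollifications times the
  -- non-negative weight $f(u_k)\eta$.
  rw [e1, Finset.sum_congr rfl fun i _ => e2 i, Finset.sum_neg_distrib, ← sub_eq_add_neg,
    ← integral_finsetSum _ (fun i _ => hint _ (hg1 i) (e i)),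
    ← integral_sub (hint _ hu1 τ) (integrable_finsetSum _ (fun i _ => hint _ (hg1 i) (e i)))]
  refine integral_nonneg fun z => ?_
  simp only [Pi.zero_apply]
  rw [← Finset.sum_mul, ← sub_mul]
  by_cases hz : z ∈ tsupport η
  · exact mul_nonneg (mollify_supersolution hu hg hsuper φ (hball z hz))
      (mul_nonneg (hf0 _ (hk0 z)) (hη0 z))
  · rw [image_eq_zero_of_notMem_tsupport hz]; simp

end WeakDerivatives

/-! ### The weak gradient of a power -/

section WeakPower

variable {X : Type*} [NormedAddCommGroup X] [NormedSpace ℝ X] [FiniteDimensional ℝ X]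
  [MeasurableSpace X] [BorelSpace X] {μ : Measure X} [μ.IsAddHaarMeasure]

theorem IsWeakLineDeriv.ae_eq {W : Set X} (hW : IsOpen W) {v d d' : X → ℝ} {w : X}
    (h : IsWeakLineDeriv μ W v d w) (h' : IsWeakLineDeriv μ W v d' w) (hd : Integrable d μ)
    (hd' : Integrable d' μ) : ∀ᵐ z ∂μ, z ∈ W → d z = d' z := by
  have := hW.ae_eq_zero_of_integral_contDiff_smul_eq_zero (μ := μ) (f := fun z => d z - d' z)
    ((hd.sub hd').locallyIntegrable.locallyIntegrableOn W) ?_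
  · filter_upwards [this] with z hz hzW
    exact sub_eq_zero.1 (hz hzW)
  · intro φ h1 h2 h3
    have ht : IsTestFunction W φ := ⟨h1, h2, h3⟩
    obtain ⟨hi, M, hM0, hM⟩ := ht.bound (μ := μ)
    have i1 : Integrable (fun z => φ z * d z) μ :=
      hd.bdd_mul h1.continuous.aestronglyMeasurable (Eventually.of_forall hM)
    have i2 : Integrable (fun z => φ z * d' z) μ :=
      hd'.bdd_mul h1.continuous.aestronglyMeasurable (Eventually.of_forall hM)
    simp_rw [smul_eq_mul, mul_sub]
    rw [integral_sub i1 i2]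
    have := (h φ ht).symm.trans (h' φ ht)
    linarith

theorem rpow_sub_one_le_one_add {m s : ℝ} (hm : 1 ≤ m) (hs : 0 ≤ s) : s ^ (m - 1) ≤ 1 + s ^ m := by
  rcases le_total s 1 with h | h
  · have := Real.rpow_le_one hs h (by linarith : 0 ≤ m - 1)
    have := Real.rpow_nonneg hs m
    linarith
  · have := Real.rpow_le_rpow_of_exponent_le h (by linarith : m - 1 ≤ m)
    linarith

/-- The weak derivative of `u ^ m` is `m u ^ (m - 1) ∂u`, as soon as both exist. -/
theorem IsWeakLineDeriv.rpow_ae_eq {W : Set X} (hW : IsOpen W) {m : ℝ} (hm : 1 < m)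
    {u d g : X → ℝ} {w : X} (hu : Integrable u μ) (hum : Integrable (fun z => u z ^ m) μ)
    (hu0 : ∀ᵐ z ∂μ, 0 ≤ u z) (hd : Integrable d μ) (hd2 : Integrable (fun z => d z ^ 2) μ)
    (hg : Integrable g μ) (hg2 : Integrable (fun z => g z ^ 2) μ)
    (h : IsWeakLineDeriv μ W u d w) (h' : IsWeakLineDeriv μ W (fun z => u z ^ m) g w) :
    ∀ᵐ z ∂μ, z ∈ W → g z = m * u z ^ (m - 1) * d z := by
  have hp : ∀ s : ℝ, 0 ≤ s → 0 < 1 + s ^ m := fun s hs => by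
    have := Real.rpow_nonneg hs m; linarith
  have hc : ∀ {p : ℝ}, 0 ≤ p → Continuous fun s : ℝ => s ^ p := fun hp =>
    Real.continuous_rpow_const hp
  -- The derivative of $s^m$ is unbounded, so the chain rule does not apply to it directly. Instead
  -- $u^m/(1+u^m)$ is differentiated twice: as a function of $u$, and as $s\mapsto s/(1+s)$ applied
  -- to $u^m$. Both have bounded derivatives, and uniqueness of weak derivatives lets the factor
  -- $(1+u^m)^{-2}$ be cancelled.
  have hb : ∀ s : ℝ, 0 ≤ s →
      HasDerivAt (fun s : ℝ => s ^ m / (1 + s ^ m)) (m * s ^ (m - 1) / (1 + s ^ m) ^ 2) s := by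
    intro s hs
    have h1 := Real.hasDerivAt_rpow_const (x := s) (p := m) (Or.inr hm.le)
    convert! h1.div (h1.const_add 1) (hp s hs).ne' using 1
    ring
  have ha : ∀ s : ℝ, 0 ≤ s → HasDerivAt (fun s : ℝ => s / (1 + s)) (1 / (1 + s) ^ 2) s := by
    intro s hs
    convert! (hasDerivAt_id s).div ((hasDerivAt_id s).const_add 1) (by positivity) using 1
    simp
  have hb'C : ∀ s : ℝ, 0 ≤ s → |m * s ^ (m - 1) / (1 + s ^ m) ^ 2| ≤ m := by
    intro s hs
    have h1 := hp s hs
    have h2 := rpow_sub_one_le_one_add hm.le hs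
    have h3 := Real.rpow_nonneg hs (m - 1)
    have h4 := Real.rpow_nonneg hs m
    rw [abs_of_nonneg (by positivity), div_le_iff₀ (by positivity)]
    gcongr
    nlinarith
  have hbcont : ContinuousOn (fun s : ℝ => m * s ^ (m - 1) / (1 + s ^ m) ^ 2) (Ici 0) := by
    refine ContinuousOn.div ?_ ?_ fun s hs => (pow_pos (hp s hs) 2).ne'
    · exact (continuous_const.mul (hc (by linarith))).continuousOn
    · exact ((continuous_const.add (hc (by linarith))).pow 2).continuousOn
  have k1 := h.comp_of_nonneg hW hu hu0 hd hd2 (C := m) hb hbcont (fun s hs => by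
    have h1 := hp s hs
    have h4 := Real.rpow_nonneg hs m
    rw [abs_of_nonneg (by positivity), div_le_iff₀ h1]
    have : 1 ≤ m * (1 + s) := by nlinarith
    nlinarith) hb'C
  have hum0 : ∀ᵐ z ∂μ, 0 ≤ u z ^ m := by
    filter_upwards [hu0] with z hz using Real.rpow_nonneg hz m
  have hacont : ContinuousOn (fun s : ℝ => 1 / (1 + s) ^ 2) (Ici 0) := by
    refine ContinuousOn.div continuousOn_const (by fun_prop) fun s hs => ?_
    have : (0 : ℝ) ≤ s := hs
    positivity
  have haC : ∀ s : ℝ, 0 ≤ s → |1 / (1 + s) ^ 2| ≤ 1 := by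
    intro s hs
    rw [abs_of_nonneg (by positivity), div_le_one (by positivity)]
    nlinarith
  have k2 := h'.comp_of_nonneg hW hum hum0 hg hg2 (C := 1) ha hacont (fun s hs => by
    rw [abs_of_nonneg (by positivity), div_le_iff₀ (by positivity)]
    nlinarith) haC
  have i1 : Integrable (fun z => m * u z ^ (m - 1) / (1 + u z ^ m) ^ 2 * d z) μ := by
    have hmeas : AEStronglyMeasurable (fun z => m * u z ^ (m - 1) / (1 + u z ^ m) ^ 2) μ := by
      have : Measurable fun s : ℝ => m * s ^ (m - 1) / (1 + s ^ m) ^ 2 := by fun_prop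
      exact (this.comp_aemeasurable hu.aestronglyMeasurable.aemeasurable).aestronglyMeasurable
    exact hd.bdd_mul hmeas (by filter_upwards [hu0] with z hz using hb'C _ hz)
  have i2 : Integrable (fun z => 1 / (1 + u z ^ m) ^ 2 * g z) μ := by
    have hmeas : AEStronglyMeasurable (fun z => 1 / (1 + u z ^ m) ^ 2) μ := by
      have : Measurable fun s : ℝ => 1 / (1 + s) ^ 2 := by fun_prop
      exact (this.comp_aemeasurable hum.aestronglyMeasurable.aemeasurable).aestronglyMeasurable
    exact hg.bdd_mul hmeas (by filter_upwards [hum0] with z hz using haC _ hz)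
  filter_upwards [k1.ae_eq hW k2 i1 i2, hu0] with z hz h0 hzW
  have h1 := hp _ h0
  have := hz hzW
  field_simp at this
  linarith

end WeakPower

/-! ### From the cylinder to functions on the whole of space-time -/

section Localization

variable {n : ℕ}

instance isAddHaarMeasure_volume_prod :
    (volume : Measure (EuclideanSpace ℝ (Fin n) × ℝ)).IsAddHaarMeasure :=
  inferInstanceAs ((volume : Measure (EuclideanSpace ℝ (Fin n))).prod
    (volume : Measure ℝ)).IsAddHaarMeasure

theorem spaceGrad_apply {φ : EuclideanSpace ℝ (Fin n) × ℝ → ℝ}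
    {z : EuclideanSpace ℝ (Fin n) × ℝ} (h : DifferentiableAt ℝ φ z) (i : Fin n) :
    spaceGrad φ z i = fderiv ℝ φ z (EuclideanSpace.single i 1, 0) := by
  have h1 : HasFDerivAt (fun x => φ (x, z.2))
      ((fderiv ℝ φ z).comp (ContinuousLinearMap.inl ℝ (EuclideanSpace ℝ (Fin n)) ℝ)) z.1 := by
    have h2 : HasFDerivAt φ (fderiv ℝ φ z) (z.1, z.2) := h.hasFDerivAt
    exact h2.comp z.1 (hasFDerivAt_prodMk_left z.1 z.2)
  have h3 : spaceGrad φ z i = inner ℝ (EuclideanSpace.single i (1 : ℝ)) (spaceGrad φ z) := by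
    simp [EuclideanSpace.inner_single_left]
  rw [h3, real_inner_comm, spaceGrad, gradient, h1.fderiv, InnerProductSpace.toDual_symm_apply]
  simp

theorem timeDeriv_eq {φ : EuclideanSpace ℝ (Fin n) × ℝ → ℝ}
    {z : EuclideanSpace ℝ (Fin n) × ℝ} (h : DifferentiableAt ℝ φ z) :
    timeDeriv φ z = fderiv ℝ φ z (0, 1) := by
  have h2 : HasFDerivAt φ (fderiv ℝ φ z) (z.1, z.2) := h.hasFDerivAt
  have h1 := (h2.comp z.2 (hasFDerivAt_prodMk_right z.1 z.2)).hasDerivAt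
  rw [timeDeriv]
  have := h1.deriv
  simpa [Function.comp_def] using this

theorem IsTestFunction.differentiableAt {X : Type*} [NormedAddCommGroup X] [NormedSpace ℝ X]
    {U : Set X} {φ : X → ℝ} (h : IsTestFunction U φ) (z : X) : DifferentiableAt ℝ φ z :=
  h.contDiff.differentiable (by simp) z

theorem IsTestFunction.mono {X : Type*} [NormedAddCommGroup X] [NormedSpace ℝ X]
    {U V : Set X} {φ : X → ℝ} (h : IsTestFunction U φ) (hUV : U ⊆ V) : IsTestFunction V φ :=
  ⟨h.contDiff, h.hasCompactSupport, h.tsupport_subset.trans hUV⟩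

theorem spaceGrad_eq_zero {φ : EuclideanSpace ℝ (Fin n) × ℝ → ℝ}
    {z : EuclideanSpace ℝ (Fin n) × ℝ} (h : z ∉ tsupport φ) : spaceGrad φ z = 0 := by
  have h1 : (fun x => φ (x, z.2)) =ᶠ[𝓝 z.1] fun _ => 0 := by
    have := notMem_tsupport_iff_eventuallyEq.1 h
    have hc : Tendsto (fun x => (x, z.2)) (𝓝 z.1) (𝓝 z) :=
      (Continuous.prodMk_left z.2).tendsto' _ _ rfl
    exact hc.eventually this
  rw [spaceGrad, gradient, h1.fderiv_eq]
  simp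

theorem timeDeriv_eq_zero {φ : EuclideanSpace ℝ (Fin n) × ℝ → ℝ}
    {z : EuclideanSpace ℝ (Fin n) × ℝ} (h : z ∉ tsupport φ) : timeDeriv φ z = 0 := by
  have h1 : (fun t => φ (z.1, t)) =ᶠ[𝓝 z.2] fun _ => 0 := by
    have := notMem_tsupport_iff_eventuallyEq.1 h
    have hc : Tendsto (fun t => (z.1, t)) (𝓝 z.2) (𝓝 z) :=
      (Continuous.prodMk_right z.1).tendsto' _ _ rfl
    exact hc.eventually this
  rw [timeDeriv, h1.deriv_eq]
  simp

theorem IsTestFunction.continuous_spaceGrad {U : Set (EuclideanSpace ℝ (Fin n) × ℝ)}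
    {φ : EuclideanSpace ℝ (Fin n) × ℝ → ℝ} (h : IsTestFunction U φ) :
    Continuous (spaceGrad φ) := by
  have : spaceGrad φ = fun z => WithLp.toLp 2 fun i =>
      fderiv ℝ φ z (EuclideanSpace.single i 1, 0) := by
    ext z i
    rw [spaceGrad_apply (h.differentiableAt z)]
  rw [this]
  refine (PiLp.continuous_toLp 2 _).comp (continuous_pi fun i => ?_)
  exact (h.contDiff.continuous_fderiv (by simp)).clm_apply continuous_const

theorem IsTestFunction.continuous_timeDeriv {U : Set (EuclideanSpace ℝ (Fin n) × ℝ)}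
    {φ : EuclideanSpace ℝ (Fin n) × ℝ → ℝ} (h : IsTestFunction U φ) :
    Continuous (timeDeriv φ) := by
  have : timeDeriv φ = fun z => fderiv ℝ φ z (0, 1) := by
    ext z
    rw [timeDeriv_eq (h.differentiableAt z)]
  rw [this]
  exact (h.contDiff.continuous_fderiv (by simp)).clm_apply continuous_const

theorem IsTestFunction.slice {Ω : Set (EuclideanSpace ℝ (Fin n))} {T : ℝ}
    {φ : EuclideanSpace ℝ (Fin n) × ℝ → ℝ} (h : IsTestFunction (cylinder Ω T) φ) (t : ℝ) :
    IsTestFunction Ω (fun x => φ (x, t)) where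
  contDiff := h.contDiff.comp (contDiff_prodMk_left t)
  hasCompactSupport := by
    have he : IsClosedEmbedding fun x : EuclideanSpace ℝ (Fin n) => (x, t) :=
      IsClosedEmbedding.of_continuous_injective_isClosedMap (Continuous.prodMk_left t)
        (Prod.mk_left_injective t) (isClosedMap_prodMk_right t)
    exact h.hasCompactSupport.comp_isClosedEmbedding he
  tsupport_subset := fun x hx =>
    (h.tsupport_subset (tsupport_comp_subset_preimage φ (Continuous.prodMk_left t) hx)).1

/-- A compact product neighbourhood of a compact subset of the cylinder. -/
theorem exists_compact_box {Ω : Set (EuclideanSpace ℝ (Fin n))} (hΩ : IsOpen Ω) {T : ℝ}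
    (hT : 0 < T) {S : Set (EuclideanSpace ℝ (Fin n) × ℝ)} (hS : IsCompact S)
    (hSΩ : S ⊆ cylinder Ω T) :
    ∃ (K : Set (EuclideanSpace ℝ (Fin n))) (a b : ℝ), IsCompact K ∧ K ⊆ Ω ∧ 0 < a ∧ b < T ∧
      S ⊆ interior K ×ˢ Ioo a b := by
  obtain ⟨K, hK, hSK, hKΩ⟩ := exists_compact_between (hS.image continuous_fst) hΩ (by
    rintro _ ⟨z, hz, rfl⟩; exact (hSΩ hz).1)
  -- Inserting `T / 2` keeps the set of times non-empty even when `S` is empty, so that the extrema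
  -- exist.
  obtain ⟨a, ha⟩ := ((hS.image continuous_snd).insert (T / 2)).exists_isLeast
    (insert_nonempty _ _)
  obtain ⟨b, hb⟩ := ((hS.image continuous_snd).insert (T / 2)).exists_isGreatest
    (insert_nonempty _ _)
  have hsub : insert (T / 2) (Prod.snd '' S) ⊆ Ioo 0 T := by
    rintro _ (rfl | ⟨z, hz, rfl⟩)
    · constructor <;> linarith
    · exact (hSΩ hz).2
  have ha0 := (hsub ha.1).1
  have hbT := (hsub hb.1).2
  refine ⟨K, a / 2, (b + T) / 2, hK, hKΩ, by linarith, by linarith, fun z hz => ?_⟩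
  have h1 := ha.2 (mem_insert_of_mem (T / 2) (mem_image_of_mem Prod.snd hz))
  have h2 := hb.2 (mem_insert_of_mem (T / 2) (mem_image_of_mem Prod.snd hz))
  exact ⟨hSK (mem_image_of_mem _ hz), by linarith, by linarith⟩

theorem integrable_indicator_of_memLp_two {α F : Type*} [MeasurableSpace α] {μ : Measure α}
    [NormedAddCommGroup F] {V : Set α} (hV : MeasurableSet V) (hfin : μ V ≠ ⊤) {f : α → F}
    (h : MemLp f 2 (μ.restrict V)) : Integrable (V.indicator f) μ := by
  have : IsFiniteMeasure (μ.restrict V) := ⟨by simpa using hfin.lt_top⟩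
  exact (integrable_indicator_iff hV).2 (h.integrable (by norm_num))

theorem integrable_indicator_sq_of_memLp_two {α : Type*} [MeasurableSpace α] {μ : Measure α}
    {V : Set α} (hV : MeasurableSet V) {f : α → ℝ}
    (h : MemLp f 2 (μ.restrict V)) : Integrable (fun z => V.indicator f z ^ 2) μ := by
  have : (fun z => V.indicator f z ^ 2) = V.indicator fun z => f z ^ 2 := by
    ext z; by_cases hz : z ∈ V <;> simp [hz]
  rw [this]
  exact (integrable_indicator_iff hV).2 h.integrable_sq

theorem MemLp.euclidean_apply {α : Type*} [MeasurableSpace α] {μ : Measure α}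
    {f : α → EuclideanSpace ℝ (Fin n)} (h : MemLp f 2 μ) (i : Fin n) :
    MemLp (fun z => f z i) 2 μ :=
  (EuclideanSpace.proj i : EuclideanSpace ℝ (Fin n) →L[ℝ] ℝ).comp_memLp' h

/-- The slicewise weak gradient is a weak gradient in space-time. -/
theorem MemL2LocH1Loc.isWeakLineDeriv {Ω : Set (EuclideanSpace ℝ (Fin n))} {T : ℝ}
    {v : EuclideanSpace ℝ (Fin n) × ℝ → ℝ}
    {Dv : EuclideanSpace ℝ (Fin n) × ℝ → EuclideanSpace ℝ (Fin n)} (h : MemL2LocH1Loc Ω T v Dv)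
    {K : Set (EuclideanSpace ℝ (Fin n))} {a b : ℝ} (hK : IsCompact K) (hKΩ : K ⊆ Ω) (ha : 0 < a)
    (hb : b < T) (i : Fin n) :
    IsWeakLineDeriv volume (interior K ×ˢ Ioo a b) ((K ×ˢ Icc a b).indicator v)
      ((K ×ˢ Icc a b).indicator fun z => Dv z i) (EuclideanSpace.single i 1, 0) := by
  intro φ hφ
  set V := K ×ˢ Icc a b
  have hVc : IsCompact V := hK.prod isCompact_Icc
  have hV : MeasurableSet V := hVc.measurableSet
  have hWV : interior K ×ˢ Ioo a b ⊆ V := prod_mono interior_subset Ioo_subset_Icc_self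
  have hVc' : V ⊆ cylinder Ω T := prod_mono hKΩ fun t ht =>
    ⟨ha.trans_le ht.1, ht.2.trans_lt hb⟩
  have hφ' : IsTestFunction (cylinder Ω T) φ := hφ.mono (hWV.trans hVc')
  have iv := integrable_indicator_of_memLp_two hV hVc.measure_lt_top.ne (h.memLp K hK hKΩ a b ha hb)
  have iDv := integrable_indicator_of_memLp_two hV hVc.measure_lt_top.ne
    (h.memLp_grad K hK hKΩ a b ha hb)
  have hgs : HasCompactSupport (spaceGrad φ) :=
    hφ.hasCompactSupport.mono' fun z hz => by_contra fun hn => hz (spaceGrad_eq_zero hn)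
  obtain ⟨M, hM⟩ := hφ.continuous_spaceGrad.bounded_above_of_compact_support hgs
  obtain ⟨-, M', -, hM'⟩ := hφ.bound (μ := volume)
  have i1 : Integrable (fun z => V.indicator v z • spaceGrad φ z) :=
    iv.smul_bdd M hφ.continuous_spaceGrad.aestronglyMeasurable (Eventually.of_forall hM)
  have i2 : Integrable (fun z => φ z • V.indicator Dv z) :=
    iDv.bdd_smul M' hφ.contDiff.continuous.aestronglyMeasurable (Eventually.of_forall hM')
  have key : ∫ z, V.indicator v z • spaceGrad φ z = - ∫ z, φ z • V.indicator Dv z := by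
    rw [Measure.volume_eq_prod] at i1 i2 ⊢
    -- With time as the outer variable, almost every slice of `φ` is a legitimate test function on
    -- `Ω`; for times outside $(0,T)$ the slice vanishes.
    rw [integral_prod_symm _ i1, integral_prod_symm _ i2, ← integral_neg]
    apply integral_congr_ae
    have hae := (ae_restrict_iff' measurableSet_Ioo).1 h.hasWeakGradient
    filter_upwards [hae] with t ht
    have hz : ∀ x, (x, t) ∉ V → (x, t) ∉ tsupport φ := fun x hx hx' =>
      hx (hWV (hφ.tsupport_subset hx'))
    by_cases htT : t ∈ Ioo 0 T
    · have := (ht htT).integral_eq _ (hφ'.slice t)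
      rw [setIntegral_eq_integral_of_forall_compl_eq_zero,
        setIntegral_eq_integral_of_forall_compl_eq_zero] at this
      · convert this using 2
        · ext1 x
          by_cases hx : (x, t) ∈ V
          · rw [indicator_of_mem hx]; rfl
          · rw [indicator_of_notMem hx]
            have := spaceGrad_eq_zero (hz x hx)
            rw [spaceGrad] at this
            simp only at this
            rw [this]; simp
        · congr 1
          ext1 x
          by_cases hx : (x, t) ∈ V
          · rw [indicator_of_mem hx]
          · rw [image_eq_zero_of_notMem_tsupport (hz x hx)]; simp
      · intro x hx
        rw [image_eq_zero_of_notMem_tsupport (hz x fun hV => hx (hVc' hV).1)]; simp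
      · intro x hx
        have := spaceGrad_eq_zero (hz x fun hV => hx (hVc' hV).1)
        rw [spaceGrad] at this
        simp only at this
        rw [this]; simp
    · have hz' : ∀ x, (x, t) ∉ tsupport φ := fun x => hz x fun hV => htT (hVc' hV).2
      simp [spaceGrad_eq_zero (hz' _), image_eq_zero_of_notMem_tsupport (hz' _)]
  have key2 := congrArg (fun y : EuclideanSpace ℝ (Fin n) => (EuclideanSpace.proj i : EuclideanSpace ℝ (Fin n) →L[ℝ] ℝ) y) key
  simp only [map_neg] at key2
  rw [← ContinuousLinearMap.integral_comp_comm _ i1,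
    ← ContinuousLinearMap.integral_comp_comm _ i2] at key2
  refine Eq.trans ?_ (key2.trans (congrArg Neg.neg ?_))
  · refine integral_congr_ae (Eventually.of_forall fun z => ?_)
    simp [spaceGrad_apply (hφ.differentiableAt z)]
  · refine integral_congr_ae (Eventually.of_forall fun z => ?_)
    by_cases hz : z ∈ V <;> simp [hz]

/-- Truncating to `V` changes nothing, because the derivatives of `φ` vanish off its support. It
makes the functions globally integrable, as mollification requires. -/
theorem supersolution_indicator {Ω : Set (EuclideanSpace ℝ (Fin n))} {T : ℝ}
    {u : EuclideanSpace ℝ (Fin n) × ℝ → ℝ}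
    {Dum : EuclideanSpace ℝ (Fin n) × ℝ → EuclideanSpace ℝ (Fin n)}
    (h : ∀ φ : EuclideanSpace ℝ (Fin n) × ℝ → ℝ, IsTestFunction (cylinder Ω T) φ → (∀ z, 0 ≤ φ z) →
      0 ≤ ∫ z in cylinder Ω T, (-(u z * timeDeriv φ z) + inner ℝ (Dum z) (spaceGrad φ z)))
    {W V : Set (EuclideanSpace ℝ (Fin n) × ℝ)} (hWV : W ⊆ V) (hV : V ⊆ cylinder Ω T)
    {φ : EuclideanSpace ℝ (Fin n) × ℝ → ℝ} (hφ : IsTestFunction W φ) (hφ0 : ∀ z, 0 ≤ φ z) :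
    0 ≤ ∫ z, (-(V.indicator u z * fderiv ℝ φ z (0, 1)) + ∑ i, V.indicator (fun z => Dum z i) z *
      fderiv ℝ φ z (EuclideanSpace.single i 1, 0)) := by
  have hz : ∀ z, z ∉ V → z ∉ tsupport φ := fun z hx hx' => hx (hWV (hφ.tsupport_subset hx'))
  refine (h φ (hφ.mono (hWV.trans hV)) hφ0).trans_eq ?_
  rw [setIntegral_eq_integral_of_forall_compl_eq_zero]
  · congr 1
    ext1 z
    simp_rw [← timeDeriv_eq (hφ.differentiableAt z), ← spaceGrad_apply (hφ.differentiableAt z)]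
    by_cases hx : z ∈ V
    · simp [hx, PiLp.inner_apply, mul_comm]
    · simp [hx, spaceGrad_eq_zero (hz z hx), timeDeriv_eq_zero (hz z hx)]
  · intro z hx
    have := hz z fun hxV => hx (hV hxV)
    simp [spaceGrad_eq_zero this, timeDeriv_eq_zero this]

end Localization

/-! ### The regularised energy estimate -/

section EnergyEstimate

variable {n : ℕ}

/-- A supersolution on space-time in terms of globally defined functions: `d i` are the weak
derivatives of `u` and `g i` those of `u ^ m`, and the differential inequality holds in `W`. -/
structure LocalSupersolution (m : ℝ) (W : Set (EuclideanSpace ℝ (Fin n) × ℝ))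
    (u : EuclideanSpace ℝ (Fin n) × ℝ → ℝ) (d g : Fin n → EuclideanSpace ℝ (Fin n) × ℝ → ℝ) :
    Prop where
  isOpen : IsOpen W
  integrable : Integrable u
  nonneg : ∀ᵐ z, 0 ≤ u z
  pos : ∀ᵐ z, z ∈ W → 0 < u z
  integrable_rpow : Integrable fun z => u z ^ m
  integrable_d : ∀ i, Integrable (d i)
  integrable_d_sq : ∀ i, Integrable fun z => d i z ^ 2
  integrable_g : ∀ i, Integrable (g i)
  integrable_g_sq : ∀ i, Integrable fun z => g i z ^ 2
  isWeakLineDeriv : ∀ i, IsWeakLineDeriv volume W u (d i) (EuclideanSpace.single i 1, 0)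
  g_eq : ∀ i, ∀ᵐ z, z ∈ W → g i z = m * u z ^ (m - 1) * d i z
  supersolution : ∀ φ : EuclideanSpace ℝ (Fin n) × ℝ → ℝ, IsTestFunction W φ → (∀ z, 0 ≤ φ z) →
    0 ≤ ∫ z, (-(u z * fderiv ℝ φ z (0, 1)) +
      ∑ i, g i z * fderiv ℝ φ z (EuclideanSpace.single i 1, 0))

/-- With `δ > 0` the power grows at most linearly, for every `ε > 0`; the integrability of $u$ and
$u^m$ then controls all terms of the estimate. -/
theorem rpow_one_sub_le {ε δ s : ℝ} (hε : 0 < ε) (hδ : 0 < δ) (hs : 0 ≤ s) :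
    (s + δ) ^ (1 - ε) ≤ δ ^ (-ε) * (s + δ) := by
  have hp : 0 < s + δ := by linarith
  rw [sub_eq_neg_add, Real.rpow_add_one hp.ne']
  exact mul_le_mul_of_nonneg_right
    (Real.rpow_le_rpow_of_nonpos hδ (by linarith) (by linarith)) hp.le

theorem integrable_mul_of_hasCompactSupport
    {f ψ : EuclideanSpace ℝ (Fin n) × ℝ → ℝ} (hf : Integrable f) (hψ : Continuous ψ)
    (hs : HasCompactSupport ψ) : Integrable fun z => f z * ψ z := by
  obtain ⟨M, hM⟩ := hψ.bounded_above_of_compact_support hs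
  exact hf.mul_bdd hψ.aestronglyMeasurable (Eventually.of_forall hM)

theorem LocalSupersolution.integrable_rpow_one_sub {m : ℝ}
    {W : Set (EuclideanSpace ℝ (Fin n) × ℝ)} {u : EuclideanSpace ℝ (Fin n) × ℝ → ℝ}
    {d g : Fin n → EuclideanSpace ℝ (Fin n) × ℝ → ℝ} (h : LocalSupersolution m W u d g)
    {ε δ : ℝ} (hε : 0 < ε) (hδ : 0 < δ) {ψ : EuclideanSpace ℝ (Fin n) × ℝ → ℝ}
    (hψ : Continuous ψ) (hs : HasCompactSupport ψ) :
    Integrable fun z => (u z + δ) ^ (1 - ε) * ψ z := by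
  have hm : Measurable fun s : ℝ => (s + δ) ^ (1 - ε) := by fun_prop
  have i0 : Integrable fun z => δ ^ (-ε) * (u z * |ψ z| + δ * |ψ z|) :=
    ((integrable_mul_of_hasCompactSupport h.integrable hψ.abs hs.norm).add
      ((hψ.abs.integrable_of_hasCompactSupport hs.norm).const_mul δ)).const_mul _
  refine i0.mono' ((hm.comp_aemeasurable
    h.integrable.aestronglyMeasurable.aemeasurable).aestronglyMeasurable.mul
    hψ.aestronglyMeasurable) ?_
  filter_upwards [h.nonneg] with z hz
  rw [norm_mul, Real.norm_eq_abs, Real.norm_eq_abs, abs_of_nonneg (by positivity)]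
  calc _ ≤ δ ^ (-ε) * (u z + δ) * |ψ z| := by gcongr; exact rpow_one_sub_le hε hδ hz
    _ = _ := by ring

theorem LocalSupersolution.integrable_rpow_sub_one {m : ℝ}
    {W : Set (EuclideanSpace ℝ (Fin n) × ℝ)} {u : EuclideanSpace ℝ (Fin n) × ℝ → ℝ}
    {d g : Fin n → EuclideanSpace ℝ (Fin n) × ℝ → ℝ} (h : LocalSupersolution m W u d g)
    (hm : 1 < m) {ψ : EuclideanSpace ℝ (Fin n) × ℝ → ℝ}
    (hψ : Continuous ψ) (hs : HasCompactSupport ψ) :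
    Integrable fun z => u z ^ (m - 1) * ψ z := by
  have hm' : Measurable fun s : ℝ => s ^ (m - 1) := by fun_prop
  have i0 : Integrable fun z => |ψ z| + u z ^ m * |ψ z| :=
    (hψ.abs.integrable_of_hasCompactSupport hs.norm).add
      (integrable_mul_of_hasCompactSupport h.integrable_rpow hψ.abs hs.norm)
  refine i0.mono' ((hm'.comp_aemeasurable
    h.integrable.aestronglyMeasurable.aemeasurable).aestronglyMeasurable.mul
    hψ.aestronglyMeasurable) ?_
  filter_upwards [h.nonneg] with z hz
  rw [norm_mul, Real.norm_eq_abs, Real.norm_eq_abs, abs_of_nonneg (by positivity)]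
  calc _ ≤ (1 + u z ^ m) * |ψ z| := by gcongr; exact rpow_sub_one_le_one_add hm.le hz
    _ = _ := by ring

theorem LocalSupersolution.integrable_rpow_mul_rpow {m : ℝ}
    {W : Set (EuclideanSpace ℝ (Fin n) × ℝ)} {u : EuclideanSpace ℝ (Fin n) × ℝ → ℝ}
    {d g : Fin n → EuclideanSpace ℝ (Fin n) × ℝ → ℝ} (h : LocalSupersolution m W u d g)
    (hm : 1 < m) {ε δ : ℝ} (hε : 0 < ε) (hδ : 0 < δ) {ψ : EuclideanSpace ℝ (Fin n) × ℝ → ℝ}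
    (hψ : Continuous ψ) (hs : HasCompactSupport ψ) :
    Integrable fun z => u z ^ (m - 1) * (u z + δ) ^ (1 - ε) * ψ z := by
  have hm' : Measurable fun s : ℝ => s ^ (m - 1) * (s + δ) ^ (1 - ε) := by fun_prop
  have i0 : Integrable fun z => δ ^ (-ε) * (u z ^ m * |ψ z| + δ * (u z ^ (m - 1) * |ψ z|)) :=
    ((integrable_mul_of_hasCompactSupport h.integrable_rpow hψ.abs hs.norm).add
      ((h.integrable_rpow_sub_one hm hψ.abs hs.norm).const_mul δ)).const_mul _
  refine i0.mono' ((hm'.comp_aemeasurable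
    h.integrable.aestronglyMeasurable.aemeasurable).aestronglyMeasurable.mul
    hψ.aestronglyMeasurable) ?_
  filter_upwards [h.nonneg] with z hz
  rw [norm_mul, Real.norm_eq_abs, Real.norm_eq_abs, abs_of_nonneg (by positivity)]
  have e : u z ^ m = u z ^ (m - 1) * u z := by
    rw [← Real.rpow_add_one' hz (by linarith)]; congr 1; ring
  calc _ ≤ u z ^ (m - 1) * (δ ^ (-ε) * (u z + δ)) * |ψ z| := by
        gcongr; exact rpow_one_sub_le hε hδ hz
    _ = _ := by rw [e]; ring

/-- The pointwise Young inequality behind the energy estimate. -/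
theorem energy_integrand_le {ι : Type*} [Fintype ι] {ε U p A x χ χ' ρ ζt : ℝ} {d q : ι → ℝ}
    (hε : 0 < ε) (hε1 : ε ≠ 1) (hU : 0 < U) (hp : 0 ≤ p) (hA : 0 ≤ A) (hx : 0 ≤ x) (hχ : 0 ≤ χ)
    (hχ1 : χ ≤ 1) (hρ : χ' * |1 - ε| = ρ * (1 - ε)) :
    -(p * U / (1 - ε) * (2 * x * ζt * χ + x ^ 2 * χ')) +
      ∑ i, (-ε * (p / U) * d i * (A * d i) * (x ^ 2 * χ) + p * (A * d i) * (2 * x * q i * χ)) ≤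
    (2 / |1 - ε| * (p * U * (x * |ζt|)) + 2 / ε * (A * (p * U) * ∑ i, q i ^ 2)) -
      (ε / 2 * (A * (p / U) * (∑ i, d i ^ 2) * (x ^ 2 * χ)) +
        1 / |1 - ε| * (p * U * x ^ 2 * ρ)) := by
  have h1 : (1 - ε) ≠ 0 := sub_ne_zero.2 (Ne.symm hε1)
  have habs : 0 < |1 - ε| := abs_pos.2 h1
  -- The relation between `χ'` and `ρ` makes this term carry the sign of `ρ`, whichever side of 1
  -- the exponent `ε` lies on.
  have e1 : p * U / (1 - ε) * (x ^ 2 * χ') = 1 / |1 - ε| * (p * U * x ^ 2 * ρ) := by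
    field_simp
    linear_combination p * x ^ 2 * hρ
  have e2 : -(p * U / (1 - ε) * (2 * x * ζt * χ)) ≤ 2 / |1 - ε| * (p * U * (x * |ζt|)) := by
    refine (neg_le_abs _).trans ?_
    rw [abs_mul, abs_div, abs_mul, abs_mul, abs_mul, abs_mul, abs_of_nonneg hp, abs_of_pos hU,
      abs_of_nonneg hx, abs_of_nonneg hχ, abs_two]
    calc p * U / |1 - ε| * (2 * x * |ζt| * χ) ≤ p * U / |1 - ε| * (2 * x * |ζt| * 1) := by gcongr
      _ = _ := by ring
  have e3 : ∑ i, (-ε * (p / U) * d i * (A * d i) * (x ^ 2 * χ) + p * (A * d i) * (2 * x * q i * χ))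
      ≤ 2 / ε * (A * (p * U) * ∑ i, q i ^ 2) -
        ε / 2 * (A * (p / U) * (∑ i, d i ^ 2) * (x ^ 2 * χ)) := by
    have : 2 / ε * (A * (p * U) * ∑ i, q i ^ 2) -
        ε / 2 * (A * (p / U) * (∑ i, d i ^ 2) * (x ^ 2 * χ)) =
        ∑ i, (2 / ε * (A * (p * U) * q i ^ 2) - ε / 2 * (A * (p / U) * d i ^ 2 * (x ^ 2 * χ))) := by
      rw [Finset.sum_sub_distrib, Finset.mul_sum, Finset.mul_sum, Finset.mul_sum, Finset.sum_mul,
        Finset.mul_sum]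
    rw [this]
    refine Finset.sum_le_sum fun i _ => ?_
    -- The Young weight is chosen so that exactly half of the coercive term, which has coefficient
    -- `ε`, is used up; this produces the factor `2 / ε`.
    have hy : 2 * (x * d i) * q i ≤ ε / (2 * U) * (x * d i) ^ 2 + 2 * U / ε * q i ^ 2 := by
      have : 0 ≤ ε / (2 * U) * (x * d i - 2 * U / ε * q i) ^ 2 := by positivity
      have e : ε / (2 * U) * (x * d i - 2 * U / ε * q i) ^ 2 =
        ε / (2 * U) * (x * d i) ^ 2 + 2 * U / ε * q i ^ 2 - 2 * (x * d i) * q i := by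
        field_simp; ring
      linarith
    calc _ = p * A * χ * (2 * (x * d i) * q i) - ε * (A * (p / U) * d i ^ 2 * (x ^ 2 * χ)) := by ring
      _ ≤ p * A * χ * (ε / (2 * U) * (x * d i) ^ 2 + 2 * U / ε * q i ^ 2)
          - ε * (A * (p / U) * d i ^ 2 * (x ^ 2 * χ)) := by gcongr
      _ = χ * (2 / ε * (A * (p * U) * q i ^ 2)) - ε / 2 * (A * (p / U) * d i ^ 2 * (x ^ 2 * χ)) := by
          field_simp; ring
      _ ≤ 1 * (2 / ε * (A * (p * U) * q i ^ 2))
          - ε / 2 * (A * (p / U) * d i ^ 2 * (x ^ 2 * χ)) := by gcongr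
      _ = _ := by rw [one_mul]
  rw [mul_add, neg_add, e1]
  linarith

/-- The energy estimate for the regularised power `(u + δ) ^ (-ε)` with a cutoff `χ` in time. -/
theorem LocalSupersolution.energy_estimate {m : ℝ} (hm : 1 < m)
    {W : Set (EuclideanSpace ℝ (Fin n) × ℝ)} {u : EuclideanSpace ℝ (Fin n) × ℝ → ℝ}
    {d g : Fin n → EuclideanSpace ℝ (Fin n) × ℝ → ℝ} (h : LocalSupersolution m W u d g)
    {ε δ : ℝ} (hε : 0 < ε) (hε1 : ε ≠ 1) (hδ : 0 < δ) {ζ : EuclideanSpace ℝ (Fin n) × ℝ → ℝ}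
    (hζ : IsTestFunction W ζ) (hζ0 : ∀ z, 0 ≤ ζ z) {χ ρ : ℝ → ℝ} (hχ : ContDiff ℝ ∞ χ)
    (hχ0 : ∀ t, 0 ≤ χ t) (hχ1 : ∀ t, χ t ≤ 1) (hρ : ∀ t, deriv χ t * |1 - ε| = ρ t * (1 - ε)) :
    Integrable (fun z => m * u z ^ (m - 1) * (u z + δ) ^ (-ε - 1) * (∑ i, d i z ^ 2) *
      (ζ z ^ 2 * χ z.2)) ∧
    ∫ z, (ε / 2 * (m * u z ^ (m - 1) * (u z + δ) ^ (-ε - 1) * (∑ i, d i z ^ 2) *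
        (ζ z ^ 2 * χ z.2)) + 1 / |1 - ε| * ((u z + δ) ^ (1 - ε) * ζ z ^ 2 * ρ z.2)) ≤
    ∫ z, (2 / |1 - ε| * ((u z + δ) ^ (1 - ε) * (ζ z * |timeDeriv ζ z|)) +
      2 / ε * (m * u z ^ (m - 1) * (u z + δ) ^ (1 - ε) * ‖spaceGrad ζ z‖ ^ 2)) := by
  have h1 : (1 - ε) ≠ 0 := sub_ne_zero.2 (Ne.symm hε1)
  have habs : 0 < |1 - ε| := abs_pos.2 h1
  have hU : ∀ s : ℝ, 0 ≤ s → 0 < s + δ := fun s hs => by linarith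
  set η : EuclideanSpace ℝ (Fin n) × ℝ → ℝ := fun z => ζ z ^ 2 * χ z.2 with hηdef
  have hχd : Differentiable ℝ χ := hχ.differentiable (by simp)
  have hηD : ∀ z w, fderiv ℝ η z w = 2 * ζ z * fderiv ℝ ζ z w * χ z.2 +
      ζ z ^ 2 * (deriv χ z.2 * w.2) := by
    intro z w
    have d1 := ((hζ.differentiableAt z).hasFDerivAt).pow 2
    have d2 : HasFDerivAt (fun z : EuclideanSpace ℝ (Fin n) × ℝ => χ z.2)
        (deriv χ z.2 • ContinuousLinearMap.snd ℝ (EuclideanSpace ℝ (Fin n)) ℝ) z :=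
      (hχd z.2).hasDerivAt.comp_hasFDerivAt z (hasFDerivAt_snd (𝕜 := ℝ))
    have := (d1.mul d2).fderiv
    have e : η = (fun z => ζ z ^ 2) * fun z : EuclideanSpace ℝ (Fin n) × ℝ => χ z.2 := rfl
    rw [e, this]
    simp
    ring
  have hη : IsTestFunction W η := by
    refine ⟨(hζ.contDiff.pow 2).mul (hχ.comp contDiff_snd), ?_, ?_⟩
    · exact hζ.hasCompactSupport.mono fun z hz hz' => hz (by simp [hηdef, hz'])
    · refine (closure_mono (Function.support_subset_iff'.2 fun z hz => ?_)).trans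
        hζ.tsupport_subset
      simp [hηdef, Function.notMem_support.1 hz]
  have hη0 : ∀ z, 0 ≤ η z := fun z => mul_nonneg (sq_nonneg _) (hχ0 _)
  have hF : ∀ s, 0 ≤ s → HasDerivAt (fun s : ℝ => (s + δ) ^ (1 - ε) / (1 - ε)) ((s + δ) ^ (-ε)) s := by
    intro s hs
    have := (((hasDerivAt_id s).add_const δ).rpow_const (p := 1 - ε)
      (Or.inl (hU s hs).ne')).div_const (1 - ε)
    convert! this using 1
    rw [show (1 - ε - 1) = -ε by ring]
    field_simp; simp
  have hf : ∀ s, 0 ≤ s → HasDerivAt (fun s : ℝ => (s + δ) ^ (-ε)) (-ε * (s + δ) ^ (-ε - 1)) s := by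
    intro s hs
    have := ((hasDerivAt_id s).add_const δ).rpow_const (p := -ε) (Or.inl (hU s hs).ne')
    convert! this using 1
    simp
  have hf' : ContinuousOn (fun s : ℝ => -ε * (s + δ) ^ (-ε - 1)) (Ici 0) :=
    continuousOn_const.mul ((continuousOn_id.add continuousOn_const).rpow_const
      fun s hs => Or.inl (hU s hs).ne')
  have hmono : ∀ {q : ℝ}, q ≤ 0 → ∀ s, 0 ≤ s → (s + δ) ^ q ≤ δ ^ q := fun hq s hs =>
    Real.rpow_le_rpow_of_nonpos hδ (by linarith) hq
  -- The three summands bound the growth of `F`, of `f` and of `f'` in turn; one constant has to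
  -- serve for all.
  set C := δ ^ (-ε) * (1 + δ) / |1 - ε| + δ ^ (-ε) + ε * δ ^ (-ε - 1) with hC
  have c1 : 0 ≤ δ ^ (-ε) * (1 + δ) / |1 - ε| := by positivity
  have c2 : 0 ≤ δ ^ (-ε) := by positivity
  have c3 : 0 ≤ ε * δ ^ (-ε - 1) := by positivity
  obtain ⟨j1, j2, j3, j4⟩ := supersolution_test_comp (C := C) h.isOpen h.integrable h.nonneg
    h.integrable_d h.integrable_d_sq h.integrable_g h.integrable_g_sq h.isWeakLineDeriv
    h.supersolution hF hf hf'
    (fun s hs => by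
      have hU' := hU s hs
      rw [abs_div, abs_of_nonneg (by positivity)]
      calc _ ≤ δ ^ (-ε) * (s + δ) / |1 - ε| := by gcongr; exact rpow_one_sub_le hε hδ hs
        _ ≤ δ ^ (-ε) * ((1 + δ) * (1 + s)) / |1 - ε| := by gcongr; nlinarith
        _ = δ ^ (-ε) * (1 + δ) / |1 - ε| * (1 + s) := by ring
        _ ≤ _ := by gcongr; linarith)
    (fun s hs => by have := hU s hs; positivity)
    (fun s hs => by
      have hU' := hU s hs
      rw [abs_of_nonneg (by positivity)]
      have := hmono (by linarith : -ε ≤ 0) s hs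
      linarith)
    (fun s hs => by
      have hU' := hU s hs
      rw [abs_mul, abs_neg, abs_of_pos hε, abs_of_nonneg (by positivity)]
      have := mul_le_mul_of_nonneg_left (hmono (by linarith : -ε - 1 ≤ 0) s hs) hε.le
      linarith) hη hη0
  have hgall := ae_all_iff.2 h.g_eq
  have hzero : ∀ z, z ∉ W → ζ z = 0 := fun z hz =>
    image_eq_zero_of_notMem_tsupport fun hz' => hz (hζ.tsupport_subset hz')
  -- Integrability of the coercive term is inherited from the tested inequality. The chain rule is
  -- known only in `W`, but `ζ` vanishes elsewhere.
  have hL1eq : ∀ᵐ z, m * u z ^ (m - 1) * (u z + δ) ^ (-ε - 1) * (∑ i, d i z ^ 2) * (ζ z ^ 2 * χ z.2)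
      = (-(1 / ε)) * ∑ i, -ε * (u z + δ) ^ (-ε - 1) * d i z * g i z * η z := by
    filter_upwards [hgall] with z hz
    by_cases hzW : z ∈ W
    · rw [Finset.mul_sum, Finset.mul_sum, Finset.sum_mul]
      refine Finset.sum_congr rfl fun i _ => ?_
      simp only [hηdef, hz i hzW]
      field_simp
    · simp [hηdef, hzero z hzW]
  have iL1 : Integrable (fun z => m * u z ^ (m - 1) * (u z + δ) ^ (-ε - 1) * (∑ i, d i z ^ 2) *
      (ζ z ^ 2 * χ z.2)) :=
    ((integrable_finsetSum _ fun i _ => j2 i).const_mul _).congr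
      (hL1eq.mono fun z hz => hz.symm)
  refine ⟨iL1, ?_⟩
  have hρeq : ∀ t, ρ t = deriv χ t * |1 - ε| / (1 - ε) := fun t => by
    rw [hρ t]; field_simp
  have hρc : Continuous ρ := by
    rw [show ρ = fun t => deriv χ t * |1 - ε| / (1 - ε) from funext hρeq]
    exact ((hχ.continuous_deriv (by simp)).mul_const _).div_const _
  have hζc := hζ.contDiff.continuous
  have iL2 : Integrable (fun z => (u z + δ) ^ (1 - ε) * ζ z ^ 2 * ρ z.2) := by
    simp_rw [mul_assoc]
    refine h.integrable_rpow_one_sub hε hδ ((hζc.pow 2).mul (hρc.comp continuous_snd)) ?_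
    exact hζ.hasCompactSupport.mono fun z hz hz' => hz (by simp [hz'])
  have iR1 : Integrable (fun z => (u z + δ) ^ (1 - ε) * (ζ z * |timeDeriv ζ z|)) :=
    h.integrable_rpow_one_sub hε hδ (hζc.mul hζ.continuous_timeDeriv.abs)
      hζ.hasCompactSupport.mul_right
  have iR2 : Integrable (fun z => m * u z ^ (m - 1) * (u z + δ) ^ (1 - ε) * ‖spaceGrad ζ z‖ ^ 2) := by
    simp_rw [mul_assoc m]
    refine (h.integrable_rpow_mul_rpow hm hε hδ (hζ.continuous_spaceGrad.norm.pow 2) ?_).const_mul m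
    exact hζ.hasCompactSupport.mono' fun z hz => by_contra fun hn =>
      hz (by simp [spaceGrad_eq_zero hn])
  have iL := (iL1.const_mul (ε / 2)).add (iL2.const_mul (1 / |1 - ε|))
  have iR := (iR1.const_mul (2 / |1 - ε|)).add (iR2.const_mul (2 / ε))
  rw [← sub_nonneg]
  have eRL := integral_sub iR iL
  simp only [Pi.add_apply] at eRL
  rw [← eRL]
  refine j4.trans ?_
  have eI : -(∫ z, (u z + δ) ^ (1 - ε) / (1 - ε) * fderiv ℝ η z (0, 1)) +
      ∑ i, ((∫ z, -ε * (u z + δ) ^ (-ε - 1) * d i z * g i z * η z) +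
        ∫ z, (u z + δ) ^ (-ε) * g i z * fderiv ℝ η z (EuclideanSpace.single i 1, 0)) =
      ∫ z, (-((u z + δ) ^ (1 - ε) / (1 - ε) * fderiv ℝ η z (0, 1)) +
        ∑ i, (-ε * (u z + δ) ^ (-ε - 1) * d i z * g i z * η z +
          (u z + δ) ^ (-ε) * g i z * fderiv ℝ η z (EuclideanSpace.single i 1, 0))) := by
    have e := integral_add j1.neg (integrable_finsetSum Finset.univ fun i _ => (j2 i).add (j3 i))
    simp only [Pi.add_apply, Pi.neg_apply] at e
    have e' := integral_finsetSum Finset.univ fun i (_ : i ∈ Finset.univ) => (j2 i).add (j3 i)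
    simp only [Pi.add_apply] at e'
    rw [e, integral_neg, e']
    congr 1
    exact Finset.sum_congr rfl fun i _ => (integral_add (j2 i) (j3 i)).symm
  refine eI.le.trans (integral_mono_ae ?_ (iR.sub iL) ?_)
  · exact j1.neg.add (integrable_finsetSum _ fun i _ => (j2 i).add (j3 i))
  · filter_upwards [hgall, h.nonneg] with z hz hu0
    have hUz := hU _ hu0
    have hn : ‖spaceGrad ζ z‖ ^ 2 = ∑ i, (fderiv ℝ ζ z (EuclideanSpace.single i 1, 0)) ^ 2 := by
      rw [EuclideanSpace.norm_sq_eq]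
      simp_rw [spaceGrad_apply (hζ.differentiableAt z), Real.norm_eq_abs, sq_abs]
    by_cases hzW : z ∈ W
    · have hp1 : (u z + δ) ^ (1 - ε) = (u z + δ) ^ (-ε) * (u z + δ) := by
        rw [sub_eq_neg_add, Real.rpow_add_one hUz.ne']
      have hp2 : (u z + δ) ^ (-ε - 1) = (u z + δ) ^ (-ε) / (u z + δ) := by
        rw [Real.rpow_sub_one hUz.ne']
      have key := energy_integrand_le (d := fun i => d i z)
        (q := fun i => fderiv ℝ ζ z (EuclideanSpace.single i 1, 0)) (ζt := timeDeriv ζ z)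
        (U := u z + δ) (p := (u z + δ) ^ (-ε)) (A := m * u z ^ (m - 1)) (x := ζ z)
        hε hε1 hUz (by positivity) (by positivity) (hζ0 z) (hχ0 z.2) (hχ1 z.2) (hρ z.2)
      rw [hn, hp1, hp2]
      refine le_trans (le_of_eq ?_) key
      congr 1
      · rw [hηD, ← timeDeriv_eq (hζ.differentiableAt z)]; simp
      · refine Finset.sum_congr rfl fun i _ => ?_
        have hηz : η z = ζ z ^ 2 * χ z.2 := rfl
        rw [hηD, hz i hzW, hηz]
        simp only [mul_zero, add_zero]
    · have hzt : z ∉ tsupport ζ := fun hz' => hzW (hζ.tsupport_subset hz')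
      have hηz : η z = 0 := by simp [hηdef, hzero z hzW]
      have hDz : ∀ w, fderiv ℝ η z w = 0 := fun w => by rw [hηD, hzero z hzW]; simp
      simp [hDz, hηz, hzero z hzW, spaceGrad_eq_zero hzt]

end EnergyEstimate

/-! ### Time cutoffs and removal of the regularisation -/

section Regularisation

variable {n : ℕ}

theorem exists_smooth_cumulative {N : ℝ → ℝ} (hN : ContDiff ℝ ∞ N) (hN0 : ∀ t, 0 ≤ N t)
    (hNi : Integrable N) (hN1 : ∫ t, N t = 1) :
    ∃ χ : ℝ → ℝ, ContDiff ℝ ∞ χ ∧ (∀ t, 0 ≤ χ t) ∧ (∀ t, χ t ≤ 1) ∧ ∀ t, HasDerivAt χ (N t) t := by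
  have hd : ∀ t, HasDerivAt (fun t => ∫ s in Iic t, N s) (N t) t := by
    intro t
    have h1 : (fun t => ∫ s in Iic t, N s) = fun t => (∫ s in (0 : ℝ)..t, N s) + ∫ s in Iic 0, N s := by
      ext t
      rw [← intervalIntegral.integral_Iic_sub_Iic hNi.integrableOn hNi.integrableOn]
      ring
    rw [h1]
    exact (hN.continuous.integral_hasStrictDerivAt 0 t).hasDerivAt.add_const _
  refine ⟨fun t => ∫ s in Iic t, N s, ?_, fun t => ?_, fun t => ?_, hd⟩
  · rw [contDiff_infty_iff_deriv, show deriv (fun t => ∫ s in Iic t, N s) = N from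
      funext fun t => (hd t).deriv]
    exact ⟨fun t => (hd t).differentiableAt, hN⟩
  · exact setIntegral_nonneg measurableSet_Iic fun s _ => hN0 s
  · rw [← hN1]
    exact setIntegral_le_integral hNi (Eventually.of_forall hN0)

/-- The cutoff is the cumulative function of `N` for $c\ge0$ and its complement for $c\le0$. It is
used with $c=1-\varepsilon$, so that the boundary-in-time term always has the favourable sign. -/
theorem exists_smooth_step {N : ℝ → ℝ} (hN : ContDiff ℝ ∞ N) (hN0 : ∀ t, 0 ≤ N t)
    (hNi : Integrable N) (hN1 : ∫ t, N t = 1) (c : ℝ) :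
    ∃ χ : ℝ → ℝ, ContDiff ℝ ∞ χ ∧ (∀ t, 0 ≤ χ t) ∧ (∀ t, χ t ≤ 1) ∧
      ∀ t, deriv χ t * |c| = N t * c := by
  obtain ⟨χ, h1, h2, h3, h4⟩ := exists_smooth_cumulative hN hN0 hNi hN1
  rcases le_total 0 c with hc | hc
  · exact ⟨χ, h1, h2, h3, fun t => by rw [(h4 t).deriv, abs_of_nonneg hc]⟩
  · refine ⟨fun t => 1 - χ t, contDiff_const.sub h1, fun t => sub_nonneg.2 (h3 t),
      fun t => by linarith [h2 t], fun t => ?_⟩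
    rw [((h4 t).const_sub 1).deriv, abs_of_nonpos hc]
    ring

theorem ae_ae_snd_of_ae {α β : Type*} [MeasurableSpace α] [MeasurableSpace β] {μ : Measure α}
    {ν : Measure β} [SFinite μ] [SFinite ν] {p : α × β → Prop} (h : ∀ᵐ z ∂μ.prod ν, p z) :
    ∀ᵐ t ∂ν, ∀ᵐ x ∂μ, p (x, t) :=
  Measure.ae_ae_of_ae_prod
    ((Measure.measurePreserving_swap (μ := ν) (ν := μ)).quasiMeasurePreserving.ae h)

/-- The right-hand side of the energy estimate with `u` regularised to `u + δ`. -/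
noncomputable def energyRHS (m ε δ : ℝ) (u ζ : EuclideanSpace ℝ (Fin n) × ℝ → ℝ)
    (z : EuclideanSpace ℝ (Fin n) × ℝ) : ℝ :=
  2 / |1 - ε| * ((u z + δ) ^ (1 - ε) * (ζ z * |timeDeriv ζ z|)) +
    2 / ε * (m * u z ^ (m - 1) * (u z + δ) ^ (1 - ε) * ‖spaceGrad ζ z‖ ^ 2)

variable {m : ℝ} {W : Set (EuclideanSpace ℝ (Fin n) × ℝ)} {u : EuclideanSpace ℝ (Fin n) × ℝ → ℝ}
    {d g : Fin n → EuclideanSpace ℝ (Fin n) × ℝ → ℝ} {ε δ : ℝ}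
    {ζ : EuclideanSpace ℝ (Fin n) × ℝ → ℝ}

theorem LocalSupersolution.integrable_energyRHS (hm : 1 < m) (h : LocalSupersolution m W u d g)
    (hε : 0 < ε) (hδ : 0 < δ) (hζ : IsTestFunction W ζ) : Integrable (energyRHS m ε δ u ζ) := by
  refine Integrable.add (Integrable.const_mul ?_ _) (Integrable.const_mul ?_ _)
  · exact h.integrable_rpow_one_sub hε hδ (hζ.contDiff.continuous.mul hζ.continuous_timeDeriv.abs)
      hζ.hasCompactSupport.mul_right
  · simp_rw [mul_assoc m]
    refine (h.integrable_rpow_mul_rpow hm hε hδ (hζ.continuous_spaceGrad.norm.pow 2) ?_).const_mul m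
    exact hζ.hasCompactSupport.mono' fun z hz => by_contra fun hn =>
      hz (by simp [spaceGrad_eq_zero hn])

theorem LocalSupersolution.gradient_estimate (hm : 1 < m) (h : LocalSupersolution m W u d g)
    (hε : 0 < ε) (hε1 : ε ≠ 1) (hδ : 0 < δ) (hζ : IsTestFunction W ζ) (hζ0 : ∀ z, 0 ≤ ζ z) :
    AEMeasurable (fun z => ENNReal.ofReal (ε / 2 * (m * u z ^ (m - 1) * (u z + δ) ^ (-ε - 1) *
      (∑ i, d i z ^ 2) * ζ z ^ 2))) ∧
    ∫⁻ z, ENNReal.ofReal (ε / 2 * (m * u z ^ (m - 1) * (u z + δ) ^ (-ε - 1) * (∑ i, d i z ^ 2) *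
      ζ z ^ 2)) ≤ ENNReal.ofReal (∫ z, energyRHS m ε δ u ζ z) := by
  obtain ⟨h1, h2⟩ := h.energy_estimate hm hε hε1 hδ hζ hζ0 (χ := fun _ => 1) (ρ := fun _ => 0)
    contDiff_const (fun _ => zero_le_one) (fun _ => le_rfl) (fun t => by simp)
  simp only [mul_one, mul_zero, add_zero] at h1 h2
  refine ⟨(h1.const_mul (ε / 2)).aestronglyMeasurable.aemeasurable.ennreal_ofReal, ?_⟩
  rw [← ofReal_integral_eq_lintegral_ofReal (h1.const_mul (ε / 2))]
  · exact ENNReal.ofReal_le_ofReal h2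
  · filter_upwards [h.nonneg] with z hz
    have : 0 ≤ u z + δ := by linarith
    have : 0 ≤ ∑ i, d i z ^ 2 := Finset.sum_nonneg fun i _ => sq_nonneg _
    simp only [Pi.zero_apply]
    positivity

/-- The bound is first proved for time averages around `τ` against a mollifier, by taking that
mollifier as the derivative of the cutoff up to sign. Lebesgue differentiation then gives it at
almost every `τ`. -/
theorem LocalSupersolution.slice_estimate (hm : 1 < m) (h : LocalSupersolution m W u d g)
    (hε : 0 < ε) (hε1 : ε ≠ 1) (hδ : 0 < δ) (hζ : IsTestFunction W ζ) (hζ0 : ∀ z, 0 ≤ ζ z) :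
    ∀ᵐ t : ℝ, AEMeasurable (fun x => ENNReal.ofReal ((u (x, t) + δ) ^ (1 - ε) * ζ (x, t) ^ 2)) ∧
      ∫⁻ x, ENNReal.ofReal ((u (x, t) + δ) ^ (1 - ε) * ζ (x, t) ^ 2) ≤
        ENNReal.ofReal (|1 - ε| * ∫ z, energyRHS m ε δ u ζ z) := by
  have habs : 0 < |1 - ε| := abs_pos.2 (sub_ne_zero.2 (Ne.symm hε1))
  have hcs : HasCompactSupport fun z => ζ z ^ 2 :=
    hζ.hasCompactSupport.mono fun z hz hz' => hz (by simp [hz'])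
  have hB : Integrable fun z => (u z + δ) ^ (1 - ε) * ζ z ^ 2 :=
    h.integrable_rpow_one_sub hε hδ (hζ.contDiff.continuous.pow 2) hcs
  have hB' : Integrable (fun z : EuclideanSpace ℝ (Fin n) × ℝ => (u z + δ) ^ (1 - ε) * ζ z ^ 2)
      (volume.prod volume) := hB
  have hb : Integrable fun t : ℝ => ∫ x, (u (x, t) + δ) ^ (1 - ε) * ζ (x, t) ^ 2 :=
    hB'.integral_prod_right
  have hu0 : ∀ᵐ t : ℝ, ∀ᵐ x, 0 ≤ u (x, t) := ae_ae_snd_of_ae h.nonneg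
  filter_upwards [ae_tendsto_mollify 1 one_pos hb, hB'.prod_left_ae, hu0] with τ hτ hτi hτ0
  refine ⟨hτi.aestronglyMeasurable.aemeasurable.ennreal_ofReal, ?_⟩
  rw [← ofReal_integral_eq_lintegral_ofReal hτi]
  · refine ENNReal.ofReal_le_ofReal (le_of_tendsto' hτ fun k => ?_)
    set φ := shrinkingBump ℝ 1 one_pos k
    set N : ℝ → ℝ := fun t => φ.normed volume (τ - t) with hNdef
    have hN : ContDiff ℝ ∞ N := φ.contDiff_normed.comp (contDiff_const.sub contDiff_id)
    obtain ⟨χ, k1, k2, k3, k4⟩ := exists_smooth_step hN (fun t => φ.nonneg_normed _)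
      (integrable_bump_sub φ τ) (integral_bump_sub φ τ) (1 - ε)
    obtain ⟨l1, l2⟩ := h.energy_estimate hm hε hε1 hδ hζ hζ0 k1 k2 k3 k4
    have iN : Integrable fun z : EuclideanSpace ℝ (Fin n) × ℝ =>
        (u z + δ) ^ (1 - ε) * ζ z ^ 2 * N z.2 := by
      simp_rw [mul_assoc]
      refine h.integrable_rpow_one_sub hε hδ ((hζ.contDiff.continuous.pow 2).mul
        (hN.continuous.comp continuous_snd)) hcs.mul_right
    have e1 : mollify volume φ (fun t => ∫ x, (u (x, t) + δ) ^ (1 - ε) * ζ (x, t) ^ 2) τ =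
        ∫ z : EuclideanSpace ℝ (Fin n) × ℝ, (u z + δ) ^ (1 - ε) * ζ z ^ 2 * N z.2 := by
      rw [mollify_apply, Measure.volume_eq_prod, integral_prod_symm _ iN]
      refine integral_congr_ae (Eventually.of_forall fun t => ?_)
      simp only
      rw [integral_mul_const, mul_comm]
    have l3 : ∫ z, 1 / |1 - ε| * ((u z + δ) ^ (1 - ε) * ζ z ^ 2 * N z.2) ≤
        ∫ z, energyRHS m ε δ u ζ z := by
      -- The gradient term is non-negative and is discarded.
      refine le_trans (integral_mono_ae (iN.const_mul _)
        ((l1.const_mul (ε / 2)).add (iN.const_mul (1 / |1 - ε|))) ?_) l2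
      filter_upwards [h.nonneg] with z hz
      have : 0 ≤ u z + δ := by linarith
      have : 0 ≤ ∑ i, d i z ^ 2 := Finset.sum_nonneg fun i _ => sq_nonneg _
      have := k2 z.2
      simp only [Pi.add_apply]
      refine le_add_of_nonneg_left ?_
      positivity
    rw [integral_const_mul, div_mul_eq_mul_div, one_mul, div_le_iff₀' habs] at l3
    rw [e1]
    exact l3
  · filter_upwards [hτ0] with x hx
    have : 0 ≤ u (x, τ) + δ := by linarith
    simp only [Pi.zero_apply]
    positivity

/-- For $\varepsilon<1$ this is subadditivity of a concave power; for $\varepsilon>1$ the power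
decreases and no error is needed. -/
theorem exists_rpow_add_le (ε : ℝ) (hε : 0 < ε) (hε1 : ε ≠ 1) :
    ∃ κ : ℕ → ℝ, Tendsto κ atTop (𝓝 0) ∧ (∀ k, 0 ≤ κ k) ∧ ∀ k : ℕ, ∀ s : ℝ, 0 < s →
      (s + 1 / ((k : ℝ) + 1)) ^ (1 - ε) ≤ s ^ (1 - ε) + κ k := by
  rcases lt_or_gt_of_ne hε1 with h | h
  · have h1 : 0 < 1 - ε := by linarith
    refine ⟨fun k => (1 / ((k : ℝ) + 1)) ^ (1 - ε), ?_, fun k => by positivity, fun k s hs => ?_⟩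
    · have := (tendsto_one_div_add_atTop_nhds_zero_nat (𝕜 := ℝ)).rpow_const
        (p := 1 - ε) (Or.inr h1.le)
      rwa [Real.zero_rpow h1.ne'] at this
    · exact Real.rpow_add_le_add_rpow hs.le (by positivity) h1.le (by linarith)
  · refine ⟨fun _ => 0, tendsto_const_nhds, fun _ => le_rfl, fun k s hs => ?_⟩
    rw [add_zero]
    exact Real.rpow_le_rpow_of_nonpos hs (by
      have : (0 : ℝ) ≤ 1 / ((k : ℝ) + 1) := by positivity
      linarith) (by linarith)

/-- The limiting right-hand side may be infinite or lack a dominating function. The additive error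
in the power is instead integrated against a fixed integrable weight, using $u^{m-1}\le1+u^m$, so it
tends to zero regardless. -/
theorem LocalSupersolution.exists_energyRHS_le (hm : 1 < m) (h : LocalSupersolution m W u d g)
    (hε : 0 < ε) (hε1 : ε ≠ 1) (hζ : IsTestFunction W ζ) (hζ0 : ∀ z, 0 ≤ ζ z) :
    ∃ κ : ℕ → ENNReal, Tendsto κ atTop (𝓝 0) ∧
      ∀ k : ℕ, ENNReal.ofReal (∫ z, energyRHS m ε (1 / ((k : ℝ) + 1)) u ζ z) ≤
        (∫⁻ z, ENNReal.ofReal (energyRHS m ε 0 u ζ z)) + κ k := by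
  obtain ⟨κ, hκ, hκ0, hκle⟩ := exists_rpow_add_le ε hε hε1
  set c : EuclideanSpace ℝ (Fin n) × ℝ → ℝ := fun z => 2 / |1 - ε| * (ζ z * |timeDeriv ζ z|) +
    2 / ε * (m * (u z ^ (m - 1) * ‖spaceGrad ζ z‖ ^ 2)) with hc
  have ic : Integrable c := by
    refine Integrable.add (Integrable.const_mul ?_ _) (Integrable.const_mul (Integrable.const_mul ?_ _) _)
    · exact (hζ.contDiff.continuous.mul
        hζ.continuous_timeDeriv.abs).integrable_of_hasCompactSupport hζ.hasCompactSupport.mul_right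
    · refine h.integrable_rpow_sub_one hm (hζ.continuous_spaceGrad.norm.pow 2) ?_
      exact hζ.hasCompactSupport.mono' fun z hz => by_contra fun hn =>
        hz (by simp [spaceGrad_eq_zero hn])
  have hcfin : ∫⁻ z, ENNReal.ofReal (c z) ≠ ⊤ := ic.lintegral_lt_top.ne
  refine ⟨fun k => ENNReal.ofReal (κ k) * ∫⁻ z, ENNReal.ofReal (c z), ?_, fun k => ?_⟩
  · have : Tendsto (fun k => ENNReal.ofReal (κ k)) atTop (𝓝 0) := by
      simpa [Function.comp_def] using (ENNReal.continuous_ofReal.tendsto 0).comp hκ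
    simpa using ENNReal.Tendsto.mul_const this (Or.inr hcfin)
  · have hδ : 0 < 1 / ((k : ℝ) + 1) := by positivity
    simp only
    rw [ofReal_integral_eq_lintegral_ofReal (h.integrable_energyRHS hm hε hδ hζ),
      ← lintegral_const_mul' _ _ ENNReal.ofReal_ne_top, ← lintegral_add_right']
    · refine lintegral_mono_ae ?_
      filter_upwards [h.pos] with z hz
      rw [← ENNReal.ofReal_mul (hκ0 k)]
      by_cases hzW : z ∈ tsupport ζ
      · have hp := hz (hζ.tsupport_subset hzW)
        have h0 := hζ0 z
        have hm0 : 0 ≤ m := by linarith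
        rw [← ENNReal.ofReal_add (by unfold energyRHS; positivity) (by
          have := hκ0 k
          simp only [hc]; positivity)]
        refine ENNReal.ofReal_le_ofReal ?_
        have := hκle k _ hp
        simp only [energyRHS, hc, add_zero]
        calc _ ≤ 2 / |1 - ε| * ((u z ^ (1 - ε) + κ k) * (ζ z * |timeDeriv ζ z|)) +
              2 / ε * (m * u z ^ (m - 1) * (u z ^ (1 - ε) + κ k) * ‖spaceGrad ζ z‖ ^ 2) := by gcongr
          _ = _ := by ring
      · simp [energyRHS, image_eq_zero_of_notMem_tsupport hzW, spaceGrad_eq_zero hzW]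
    · exact ic.aestronglyMeasurable.aemeasurable.ennreal_ofReal.const_mul _
    · filter_upwards [h.nonneg] with z hz
      have h0 := hζ0 z
      have hm0 : 0 ≤ m := by linarith
      have : 0 ≤ u z + 1 / ((k : ℝ) + 1) := by linarith
      simp only [Pi.zero_apply, energyRHS]
      positivity

theorem lintegral_le_of_tendsto_of_le {α : Type*} [MeasurableSpace α] {μ : Measure α}
    {f : ℕ → α → ENNReal} {F : α → ENNReal} {b : ℕ → ENNReal} {B : ENNReal}
    (hf : ∀ k, AEMeasurable (f k) μ) (hfF : ∀ᵐ x ∂μ, Tendsto (fun k => f k x) atTop (𝓝 (F x)))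
    (hb : Tendsto b atTop (𝓝 B)) (hle : ∀ k, ∫⁻ x, f k x ∂μ ≤ b k) : ∫⁻ x, F x ∂μ ≤ B := by
  calc ∫⁻ x, F x ∂μ = ∫⁻ x, liminf (fun k => f k x) atTop ∂μ :=
        lintegral_congr_ae (hfF.mono fun x hx => hx.liminf_eq.symm)
    _ ≤ liminf (fun k => ∫⁻ x, f k x ∂μ) atTop := lintegral_liminf_le' hf
    _ ≤ liminf b atTop := liminf_le_liminf (Eventually.of_forall hle)
    _ = B := hb.liminf_eq

theorem tendsto_add_one_div_rpow {s : ℝ} (hs : 0 < s) (p : ℝ) :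
    Tendsto (fun k : ℕ => (s + 1 / ((k : ℝ) + 1)) ^ p) atTop (𝓝 (s ^ p)) := by
  have h1 : Tendsto (fun k : ℕ => s + 1 / ((k : ℝ) + 1)) atTop (𝓝 s) := by
    simpa using (tendsto_one_div_add_atTop_nhds_zero_nat (𝕜 := ℝ)).const_add s
  exact h1.rpow_const (Or.inl hs.ne')

/-- Fatou's lemma handles both left-hand sides. Positivity of $u$ on the support of `ζ` is what
makes the regularised powers converge pointwise. -/
theorem LocalSupersolution.caccioppoli (hm : 1 < m) (h : LocalSupersolution m W u d g)
    (hε : 0 < ε) (hε1 : ε ≠ 1) (hζ : IsTestFunction W ζ) (hζ0 : ∀ z, 0 ≤ ζ z) :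
    (∫⁻ z, ENNReal.ofReal (ε / 2 * (m * u z ^ (m - 1) * u z ^ (-ε - 1) * (∑ i, d i z ^ 2) *
      ζ z ^ 2)) ≤ ∫⁻ z, ENNReal.ofReal (energyRHS m ε 0 u ζ z)) ∧
    ∀ᵐ t : ℝ, ∫⁻ x, ENNReal.ofReal (u (x, t) ^ (1 - ε) * ζ (x, t) ^ 2) ≤
      ENNReal.ofReal |1 - ε| * ∫⁻ z, ENNReal.ofReal (energyRHS m ε 0 u ζ z) := by
  obtain ⟨κ, hκ, hκle⟩ := h.exists_energyRHS_le hm hε hε1 hζ hζ0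
  have hB := hκ.const_add (∫⁻ z, ENNReal.ofReal (energyRHS m ε 0 u ζ z))
  rw [add_zero] at hB
  have hδ : ∀ k : ℕ, 0 < 1 / ((k : ℝ) + 1) := fun k => by positivity
  constructor
  · refine lintegral_le_of_tendsto_of_le
      (fun k => (h.gradient_estimate hm hε hε1 (hδ k) hζ hζ0).1) ?_ hB
      (fun k => (h.gradient_estimate hm hε hε1 (hδ k) hζ hζ0).2.trans (hκle k))
    filter_upwards [h.pos] with z hz
    by_cases hzW : z ∈ tsupport ζ
    · have hp := hz (hζ.tsupport_subset hzW)
      refine (ENNReal.continuous_ofReal.tendsto _).comp ?_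
      exact ((((tendsto_add_one_div_rpow hp _).const_mul _).mul_const _).mul_const _).const_mul _
    · simp [image_eq_zero_of_notMem_tsupport hzW]
  · have hs := ae_all_iff.2 fun k => h.slice_estimate hm hε hε1 (hδ k) hζ hζ0
    have hpos : ∀ᵐ t : ℝ, ∀ᵐ x, (x, t) ∈ W → 0 < u (x, t) := ae_ae_snd_of_ae h.pos
    filter_upwards [hs, hpos] with t ht htp
    refine lintegral_le_of_tendsto_of_le (fun k => (ht k).1) ?_
      (ENNReal.Tendsto.const_mul hB (Or.inr ENNReal.ofReal_ne_top)) fun k => ?_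
    · filter_upwards [htp] with x hx
      by_cases hzW : (x, t) ∈ tsupport ζ
      · have hp := hx (hζ.tsupport_subset hzW)
        refine (ENNReal.continuous_ofReal.tendsto _).comp ?_
        exact (tendsto_add_one_div_rpow hp _).mul_const _
      · simp [image_eq_zero_of_notMem_tsupport hzW]
    · refine (ht k).2.trans ?_
      rw [ENNReal.ofReal_mul (abs_nonneg _)]
      gcongr
      exact hκle k

end Regularisation

/-! ### Assembly of the estimate -/

/-- Restriction of a positive weak supersolution to a compact box. -/
theorem localSupersolution_indicator {n : ℕ} {m : ℝ} (hm : 1 < m)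
    {Ω : Set (EuclideanSpace ℝ (Fin n))} {T : ℝ} {u : EuclideanSpace ℝ (Fin n) × ℝ → ℝ}
    {Du Dum : EuclideanSpace ℝ (Fin n) × ℝ → EuclideanSpace ℝ (Fin n)}
    (hu : ∀ᵐ z ∂(volume.restrict (cylinder Ω T)), 0 < u z) (hDu : MemL2LocH1Loc Ω T u Du)
    (hDum : MemL2LocH1Loc Ω T (fun z => u z ^ m) Dum)
    (hsuper : ∀ φ : EuclideanSpace ℝ (Fin n) × ℝ → ℝ, IsTestFunction (cylinder Ω T) φ →
      (∀ z, 0 ≤ φ z) →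
      0 ≤ ∫ z in cylinder Ω T, (-(u z * timeDeriv φ z) + inner ℝ (Dum z) (spaceGrad φ z)))
    {K : Set (EuclideanSpace ℝ (Fin n))} {a b : ℝ} (hK : IsCompact K) (hKΩ : K ⊆ Ω) (ha : 0 < a)
    (hb : b < T) :
    LocalSupersolution m (interior K ×ˢ Ioo a b) ((K ×ˢ Icc a b).indicator u)
      (fun i => (K ×ˢ Icc a b).indicator fun z => Du z i)
      (fun i => (K ×ˢ Icc a b).indicator fun z => Dum z i) := by
  set V := K ×ˢ Icc a b with hVdef
  have hVc : IsCompact V := hK.prod isCompact_Icc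
  have hV : MeasurableSet V := hVc.measurableSet
  have hfin : volume V ≠ ⊤ := hVc.measure_lt_top.ne
  have hWV : interior K ×ˢ Ioo a b ⊆ V := prod_mono interior_subset Ioo_subset_Icc_self
  have hVΩ : V ⊆ cylinder Ω T := prod_mono hKΩ fun t ht => ⟨ha.trans_le ht.1, ht.2.trans_lt hb⟩
  have hm0 : m ≠ 0 := by linarith
  have hpos : ∀ᵐ z, z ∈ V → 0 < u z :=
    (ae_restrict_iff' hV).1 (ae_restrict_of_ae_restrict_of_subset hVΩ hu)
  have hrpow : (fun z => V.indicator u z ^ m) = V.indicator fun z => u z ^ m := by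
    ext z
    by_cases hz : z ∈ V <;> simp [hz, Real.zero_rpow hm0]
  have hnonneg : ∀ᵐ z, 0 ≤ V.indicator u z := by
    filter_upwards [hpos] with z hz
    exact indicator_apply_nonneg fun h => (hz h).le
  have iu := integrable_indicator_of_memLp_two hV hfin (hDu.memLp K hK hKΩ a b ha hb)
  have ium := integrable_indicator_of_memLp_two hV hfin (hDum.memLp K hK hKΩ a b ha hb)
  have hd := fun i => MemLp.euclidean_apply (hDu.memLp_grad K hK hKΩ a b ha hb) i
  have hg := fun i => MemLp.euclidean_apply (hDum.memLp_grad K hK hKΩ a b ha hb) i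
  have hwu := fun i => hDu.isWeakLineDeriv hK hKΩ ha hb i
  have hwum := fun i => hDum.isWeakLineDeriv hK hKΩ ha hb i
  exact
  { isOpen := isOpen_interior.prod isOpen_Ioo
    integrable := iu
    nonneg := hnonneg
    pos := by
      filter_upwards [hpos] with z hz hzW
      rw [indicator_of_mem (hWV hzW)]
      exact hz (hWV hzW)
    integrable_rpow := hrpow ▸ ium
    integrable_d := fun i => integrable_indicator_of_memLp_two hV hfin (hd i)
    integrable_d_sq := fun i => integrable_indicator_sq_of_memLp_two hV (hd i)
    integrable_g := fun i => integrable_indicator_of_memLp_two hV hfin (hg i)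
    integrable_g_sq := fun i => integrable_indicator_sq_of_memLp_two hV (hg i)
    isWeakLineDeriv := hwu
    g_eq := fun i => (hwu i).rpow_ae_eq (isOpen_interior.prod isOpen_Ioo) hm iu (hrpow ▸ ium)
      hnonneg (integrable_indicator_of_memLp_two hV hfin (hd i))
      (integrable_indicator_sq_of_memLp_two hV (hd i))
      (integrable_indicator_of_memLp_two hV hfin (hg i))
      (integrable_indicator_sq_of_memLp_two hV (hg i)) (hrpow ▸ hwum i)
    supersolution := fun φ hφ hφ0 => supersolution_indicator hsuper hWV hVΩ hφ hφ0 }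

/-- The two bounds cost $2J/\varepsilon$ and $J/\varepsilon$; the total $3J/\varepsilon$, with the
coefficients 2 inside $J$, yields the constants 6. -/
theorem combine_energy_bounds {ε m c : ℝ} (hε : 0 < ε) (hm : 0 < m) (hc : 0 < c)
    {I J P Q S : ENNReal} (hI : ENNReal.ofReal (ε / 2) * I ≤ J) (hS : S ≤ ENNReal.ofReal c * J)
    (hJ : J = ENNReal.ofReal (2 / c) * Q + ENNReal.ofReal (2 / ε * m) * P) :
    I + ENNReal.ofReal (1 / (ε * c)) * S ≤
      ENNReal.ofReal (6 * m / ε ^ 2) * P + ENNReal.ofReal (6 / (ε * c)) * Q := by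
  have h1 : I ≤ ENNReal.ofReal (2 / ε) * J := by
    calc I = ENNReal.ofReal (2 / ε) * (ENNReal.ofReal (ε / 2) * I) := by
          rw [← mul_assoc, ← ENNReal.ofReal_mul (by positivity),
            show 2 / ε * (ε / 2) = 1 by field_simp, ENNReal.ofReal_one, one_mul]
      _ ≤ _ := by gcongr
  have h2 : ENNReal.ofReal (1 / (ε * c)) * S ≤ ENNReal.ofReal (1 / ε) * J := by
    calc _ ≤ ENNReal.ofReal (1 / (ε * c)) * (ENNReal.ofReal c * J) := by gcongr
      _ = _ := by
          rw [← mul_assoc, ← ENNReal.ofReal_mul (by positivity),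
            show 1 / (ε * c) * c = 1 / ε by field_simp]
  refine (add_le_add h1 h2).trans_eq ?_
  rw [← add_mul, ← ENNReal.ofReal_add (by positivity) (by positivity), hJ, mul_add, ← mul_assoc,
    ← mul_assoc, ← ENNReal.ofReal_mul (by positivity), ← ENNReal.ofReal_mul (by positivity), add_comm]
  congr 3
  · field_simp; ring
  · field_simp; ring

end PME

theorem lemma2p3 :
    ∃ C₁ C₂ : ℝ, 0 < C₁ ∧ 0 < C₂ ∧
      ∀ (n : ℕ) (m : ℝ) (Ω : Set (EuclideanSpace ℝ (Fin n))) (T : ℝ)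
        (u : EuclideanSpace ℝ (Fin n) × ℝ → ℝ)
        (Du : EuclideanSpace ℝ (Fin n) × ℝ → EuclideanSpace ℝ (Fin n))
        (ζ : EuclideanSpace ℝ (Fin n) × ℝ → ℝ) (ε : ℝ),
        1 ≤ n → 1 < m →
        IsOpen Ω → IsConnected Ω → Bornology.IsBounded Ω → 0 < T →
        PME.IsWeakSupersolution m Ω T u →
        (∀ᵐ z ∂(volume.restrict (PME.cylinder Ω T)), 0 < u z) →
        PME.MemL2LocH1Loc Ω T u Du →
        PME.IsTestFunction (PME.cylinder Ω T) ζ → (∀ z, 0 ≤ ζ z ∧ ζ z ≤ 1) →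
        0 < ε → ε ≠ 1 →
        (∫⁻ z in PME.cylinder Ω T,
            ENNReal.ofReal (m * u z ^ (m - ε - 2) * ζ z ^ 2 * ‖Du z‖ ^ 2))
          + ENNReal.ofReal (1 / (ε * |1 - ε|)) *
            essSup (fun t => ∫⁻ x in Ω, ENNReal.ofReal (u (x, t) ^ (1 - ε) * ζ (x, t) ^ 2))
              (volume.restrict (Ioo 0 T))
        ≤ ENNReal.ofReal (C₁ * m / ε ^ 2) *
            (∫⁻ z in PME.cylinder Ω T,
              ENNReal.ofReal (u z ^ (m - ε) * ‖PME.spaceGrad ζ z‖ ^ 2))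
          + ENNReal.ofReal (C₂ / (ε * |1 - ε|)) *
            (∫⁻ z in PME.cylinder Ω T,
              ENNReal.ofReal (u z ^ (1 - ε) * ζ z * |PME.timeDeriv ζ z|)) := by
  refine ⟨6, 6, by norm_num, by norm_num, ?_⟩
  intro n m Ω T u Du ζ ε _ hm hΩ _ _ hT husup hu hDu hζ hζ01 hε hε1
  obtain ⟨Dum, hDum, hsuper⟩ := husup.supersolution
  obtain ⟨K, a, b, hK, hKΩ, ha, hb, hS⟩ := PME.exists_compact_box hΩ hT
    hζ.hasCompactSupport.isCompact hζ.tsupport_subset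
  have hζW : PME.IsTestFunction (interior K ×ˢ Ioo a b) ζ :=
    ⟨hζ.contDiff, hζ.hasCompactSupport, hS⟩
  have hloc := PME.localSupersolution_indicator hm hu hDu hDum hsuper hK hKΩ ha hb
  have hζ0 := fun z => (hζ01 z).1
  obtain ⟨hI, hA⟩ := hloc.caccioppoli hm hε hε1 hζW hζ0
  have hpos := hloc.pos
  set V := K ×ˢ Icc a b
  have hWV : interior K ×ˢ Ioo a b ⊆ V := prod_mono interior_subset Ioo_subset_Icc_self
  have habs : 0 < |1 - ε| := abs_pos.2 (sub_ne_zero.2 (Ne.symm hε1))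
  have hm0 : 0 < m := by linarith
  have hmemV : ∀ z ∈ tsupport ζ, z ∈ V := fun z hz => hWV (hS hz)
  have hζz : ∀ z, z ∉ tsupport ζ → ζ z = 0 := fun z hz => image_eq_zero_of_notMem_tsupport hz
  have hsub : ∀ f : EuclideanSpace ℝ (Fin n) × ℝ → ENNReal, (∀ z, z ∉ tsupport ζ → f z = 0) →
      ∫⁻ z in PME.cylinder Ω T, f z = ∫⁻ z, f z := fun f hf =>
    setLIntegral_eq_of_support_subset fun z hz => hζ.tsupport_subset
      (by_contra fun hn => hz (hf z hn))
  refine PME.combine_energy_bounds hε hm0 habs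
    (J := ∫⁻ z, ENNReal.ofReal (PME.energyRHS m ε 0 (V.indicator u) ζ z)) ?_ ?_ ?_
  · rw [hsub _ fun z hz => by simp [hζz z hz],
      ← lintegral_const_mul' _ _ ENNReal.ofReal_ne_top]
    refine le_trans (le_of_eq (lintegral_congr_ae ?_)) hI
    filter_upwards [hpos] with z hz
    rw [← ENNReal.ofReal_mul (by positivity)]
    by_cases hzS : z ∈ tsupport ζ
    · have hzV := hmemV z hzS
      have hp := hz (hS hzS)
      simp only [indicator_of_mem hzV] at hp ⊢
      have e : u z ^ (m - ε - 2) = u z ^ (m - 1) * u z ^ (-ε - 1) := by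
        rw [← Real.rpow_add hp]; congr 1; ring
      rw [e, EuclideanSpace.norm_sq_eq]
      simp_rw [Real.norm_eq_abs, sq_abs]
      congr 1; ring
    · simp [hζz z hzS]
  -- The slice bound holds at almost every time with a right-hand side independent of the time,
  -- hence it bounds the essential supremum.
  · refine essSup_le_of_ae_le _ ?_
    refine ae_restrict_of_ae ?_
    filter_upwards [hA] with t ht
    rw [setLIntegral_eq_of_support_subset]
    · refine le_trans (le_of_eq (lintegral_congr fun x => ?_)) ht
      by_cases hzS : (x, t) ∈ tsupport ζ
      · rw [indicator_of_mem (hmemV _ hzS)]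
      · simp [hζz _ hzS]
    · intro x hx
      by_contra hn
      exact hx (by simp [hζz (x, t) fun h => hn (hζ.tsupport_subset h).1])
  · rw [hsub _ fun z hz => by simp [hζz z hz],
      hsub _ fun z hz => by simp [PME.spaceGrad_eq_zero hz],
      ← lintegral_const_mul' _ _ ENNReal.ofReal_ne_top,
      ← lintegral_const_mul' _ _ ENNReal.ofReal_ne_top, ← lintegral_add_left']
    · refine lintegral_congr_ae ?_
      filter_upwards [hpos] with z hz
      rw [← ENNReal.ofReal_mul (by positivity), ← ENNReal.ofReal_mul (by positivity)]
      by_cases hzS : z ∈ tsupport ζ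
      · have hzV := hmemV z hzS
        have hp := hz (hS hzS)
        have h0 := hζ0 z
        simp only [PME.energyRHS, indicator_of_mem hzV] at hp ⊢
        rw [← ENNReal.ofReal_add (by positivity) (by positivity)]
        have e : u z ^ (m - ε) = u z ^ (m - 1) * u z ^ (1 - ε) := by
          rw [← Real.rpow_add hp]; congr 1; ring
        rw [e, add_zero]
        congr 1; ring
      · simp [PME.energyRHS, hζz z hzS, PME.spaceGrad_eq_zero hzS]
    -- Measurability is at hand for the truncated function; the two integrands agree because `ζ`
    -- vanishes outside the box.
    · have hmeas : AEMeasurable fun z => ENNReal.ofReal (2 / |1 - ε|) *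
          ENNReal.ofReal (V.indicator u z ^ (1 - ε) * ζ z * |PME.timeDeriv ζ z|) :=
        ((((hloc.integrable.aestronglyMeasurable.aemeasurable.pow_const (1 - ε)).mul
          hζ.contDiff.continuous.aemeasurable).mul
          hζ.continuous_timeDeriv.abs.aemeasurable).ennreal_ofReal).const_mul _
      refine hmeas.congr (Eventually.of_forall fun z => ?_)
      by_cases hzS : z ∈ tsupport ζ
      · simp only [indicator_of_mem (hmemV z hzS)]
      · simp [hζz z hzS]
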